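/- Consider absolutely continuous paths $g\colon[0,T]\to\mathbb R^2$ ($T\ge 0$) with $g(0)=(0,0)$. Write $\hat g=(x_g,y_g)=g(T)$ for the endpoint of $g$. Let $g_c$ be the closed path obtained by following $g$ and then the segment from $\hat g$ back to $(0,0)$, and for $(x,y)\in\mathbb R^2\setminus\mathrm{Im}(g_c)$ let $w_g(x,y)\in\mathbb Z$ be the winding number of $g_c$ around $(x,y)$ (positive for counterclockwise turns). Set \[ A(g)=\iint_{\mathbb R^2\setminus \mathrm{Im}(g_c)} w_g(x,y)\,\mathrm dx\,\mathrm dy,\qquad B_y(g)=\iint_{\mathbb R^2\setminus \mathrm{Im}(g_c)} y\,w_g(x,y)\,\mathrm dx\,\mathrm dy. \] Two paths are called equivalent if they have the same $\hat g$, the same $A(g)$ and the same $B_y(g)$. The concatenation $gh$ follows $g$ and then the translate of $h$ by $\hat g$; the reverse of $g$ is $t\mapsto g(T-t)-\hat g$; the empty path is the path with $T=0$. For $u,v\in\mathbb R^2$ let $\det(u,v)=u_1v_2-u_2v_1$. Then the winding numbers are well defined and the integrals defining $A(g)$ and $B_y(g)$ converge absolutely for every path $g$, and for all paths $g,h$ \begin{align*}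 \widehat{gh} &= \hat g+\hat h,\\ A(gh) &= A(g)+A(h)+\tfrac12\det(\hat g,\hat h),\\ B_y(gh) &= B_y(g)+B_y(h)+y_g\cdot A(h)+\tfrac13(2y_g+y_h)\cdot\tfrac12\det(\hat g,\hat h). \end{align*} Consequently concatenation passes to the quotient: if $g$ is equivalent to $g'$ and $h$ to $h'$, then $gh$ is equivalent to $g'h'$. With the class of the empty path as neutral element and the classes of reverse paths as inverses, this makes the set $\bar{\mathcal E}$ of equivalence classes a group. Moreover, $(x_g,y_g,A(g),B_y(g))$ is a bijection from $\bar{\mathcal E}$ onto $\mathbb R^4$ which, used as a global chart, makes $\bar{\mathcal E}$ a Lie group, and $\bar{\mathcal E}$ is the Engel group: the map \[ [g]\longmapsto \begin{pmatrix}1&a&a^2/2&d\\0&1&a&c\\0&0&1&b\\0&0&0&1\end{pmatrix},\qquad a=y_g,\quad b=x_g,\quad c=\tfrac12x_gy_g-A(g),\quad d=\tfrac16x_gy_g^2-B_y(g), \] is a group isomorphism from $\bar{\mathcal E}$ onto the group of all real matrices of this form. -/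

import Mathlib

open Set MeasureTheory
open scoped ContDiff Manifold

/-- An absolutely continuous path in the plane `ℝ²`, parametrised by `[0, T]` for some `T ≥ 0`
(the field `dur`), and starting from the origin. The values of `toFun` outside `[0, T]` play no
role. -/
structure PlanarPath where
  dur : ℝ
  dur_nonneg : 0 ≤ dur
  toFun : ℝ → ℝ × ℝ
  start : toFun 0 = 0
  ac : AbsolutelyContinuousOnInterval toFun 0 dur

/-- Absolute continuity is preserved by a change of parameter which is monotone or antitone and
does not increase distances. -/
theorem acOn_comp_of_monotone_or_antitone {f : ℝ → ℝ × ℝ} {φ : ℝ → ℝ} {a b c d : ℝ}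
    (hf : AbsolutelyContinuousOnInterval f c d) (hφ : Monotone φ ∨ Antitone φ)
    (hL : ∀ s t, dist (φ s) (φ t) ≤ dist s t)
    (hm : ∀ t ∈ uIcc a b, φ t ∈ uIcc c d) :
    AbsolutelyContinuousOnInterval (fun t => f (φ t)) a b := by
  rw [absolutelyContinuousOnInterval_iff] at hf ⊢
  intro ε hε
  obtain ⟨δ, hδ, h⟩ := hf ε hε
  refine ⟨δ, hδ, fun E hE hlen => ?_⟩
  refine h (E.1, fun i => (φ (E.2 i).1, φ (E.2 i).2)) ⟨?_, ?_⟩ ?_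
  · intro i hi
    exact ⟨hm _ (hE.1 i hi).1, hm _ (hE.1 i hi).2⟩
  · intro i hi j hj hij
    have hd : Disjoint (uIoc (E.2 i).1 (E.2 i).2) (uIoc (E.2 j).1 (E.2 j).2) := hE.2 hi hj hij
    change Disjoint (uIoc (φ (E.2 i).1) (φ (E.2 i).2)) (uIoc (φ (E.2 j).1) (φ (E.2 j).2))
    generalize (E.2 i).1 = p at *
    generalize (E.2 i).2 = q at *
    generalize (E.2 j).1 = r at *
    generalize (E.2 j).2 = s at *
    have key : p = q ∨ r = s ∨ max p q ≤ min r s ∨ max r s ≤ min p q := by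
      by_contra hcon
      push Not at hcon
      obtain ⟨h1, h2, h3, h4⟩ := hcon
      have hpq : min p q < max p q := min_lt_max.2 h1
      have hrs : min r s < max r s := min_lt_max.2 h2
      have hd' := Set.disjoint_left.1 hd
      exact hd' (a := min (max p q) (max r s)) ⟨lt_min hpq h4, min_le_left _ _⟩ ⟨lt_min h3 hrs, min_le_right _ _⟩
    rcases key with rfl | rfl | hk | hk
    · simp
    · simp
    · rw [max_le_iff, le_min_iff, le_min_iff] at hk
      obtain ⟨⟨h1, h2⟩, h3, h4⟩ := hk
      rw [Set.disjoint_left]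
      intro x hx hy
      rw [Set.mem_uIoc] at hx hy
      rcases hφ with hφ | hφ <;>
      · have := hφ h1
        have := hφ h2
        have := hφ h3
        have := hφ h4
        rcases hx with hx | hx <;> rcases hy with hy | hy <;> linarith [hx.1, hx.2, hy.1, hy.2]
    · rw [max_le_iff, le_min_iff, le_min_iff] at hk
      obtain ⟨⟨h1, h2⟩, h3, h4⟩ := hk
      rw [Set.disjoint_left]
      intro x hx hy
      rw [Set.mem_uIoc] at hx hy
      rcases hφ with hφ | hφ <;>
      · have := hφ h1
        have := hφ h2
        have := hφ h3
        have := hφ h4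
        rcases hx with hx | hx <;> rcases hy with hy | hy <;> linarith [hx.1, hx.2, hy.1, hy.2]
  · exact lt_of_le_of_lt (Finset.sum_le_sum fun i _ => hL _ _) hlen

theorem acOn_const (v : ℝ × ℝ) (a b : ℝ) :
    AbsolutelyContinuousOnInterval (fun _ : ℝ => v) a b :=
  (contDiff_const (c := v) (n := 1)).contDiffOn.absolutelyContinuousOnInterval

namespace PlanarPath

/-- The second endpoint `ĝ = (x_g, y_g)` of a path. -/
def endpoint (g : PlanarPath) : ℝ × ℝ := g.toFun g.dur

/-- The empty path (of duration `0`). -/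
def empty : PlanarPath where
  dur := 0
  dur_nonneg := le_rfl
  toFun := fun _ => 0
  start := rfl
  ac := acOn_const 0 0 0

/-- The straight segment from the origin to `v`. -/
def segment (v : ℝ × ℝ) : PlanarPath where
  dur := 1
  dur_nonneg := zero_le_one
  toFun := fun t => t • v
  start := zero_smul ℝ v
  ac := by
    have h : ContDiff ℝ 1 (fun t : ℝ => t • v) := by fun_prop
    exact h.contDiffOn.absolutelyContinuousOnInterval

theorem concat_fun_eq (g h : PlanarPath) :
    (fun t : ℝ => if t ≤ g.dur then g.toFun t else g.endpoint + h.toFun (t - g.dur)) =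
      fun t => g.toFun (min t g.dur) + h.toFun (max 0 (t - g.dur)) := by
  funext t
  by_cases ht : t ≤ g.dur
  · rw [if_pos ht, min_eq_left ht, max_eq_left (by linarith), h.start, add_zero]
  · rw [if_neg ht, min_eq_right (by linarith), max_eq_right (by linarith)]
    rfl

/-- The concatenation `gh`: first follow `g`, then follow the translate of `h` that starts at the
endpoint of `g`. -/
noncomputable def concat (g h : PlanarPath) : PlanarPath where
  dur := g.dur + h.dur
  dur_nonneg := add_nonneg g.dur_nonneg h.dur_nonneg
  toFun := fun t => if t ≤ g.dur then g.toFun t else g.endpoint + h.toFun (t - g.dur)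
  start := by rw [if_pos g.dur_nonneg, g.start]
  ac := by
    rw [concat_fun_eq]
    have hg := g.dur_nonneg
    have hh := h.dur_nonneg
    refine AbsolutelyContinuousOnInterval.add
      (f := fun t => g.toFun (min t g.dur)) (g := fun t => h.toFun (max 0 (t - g.dur)))
      (acOn_comp_of_monotone_or_antitone g.ac (Or.inl ?_) ?_ ?_)
      (acOn_comp_of_monotone_or_antitone h.ac (Or.inl ?_) ?_ ?_)
    · exact fun s t hst => min_le_min_right _ hst
    · intro s t
      simpa [Real.dist_eq] using abs_min_sub_min_le_max s g.dur t g.dur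
    · intro t ht
      rw [uIcc_of_le (by linarith), mem_Icc] at ht
      rw [uIcc_of_le hg]
      exact ⟨le_min ht.1 hg, min_le_right _ _⟩
    · exact fun s t hst => max_le_max_left _ (by linarith)
    · intro s t
      simpa [Real.dist_eq] using abs_max_sub_max_le_max 0 (s - g.dur) 0 (t - g.dur)
    · intro t ht
      rw [uIcc_of_le (by linarith), mem_Icc] at ht
      rw [uIcc_of_le hh]
      exact ⟨le_max_left _ _, max_le hh (by linarith)⟩

/-- The reverse path: `g` travelled backwards, translated so as to start at the origin. -/
noncomputable def reverse (g : PlanarPath) : PlanarPath where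
  dur := g.dur
  dur_nonneg := g.dur_nonneg
  toFun := fun t => g.toFun (g.dur - t) - g.endpoint
  start := by simp [endpoint]
  ac := by
    refine AbsolutelyContinuousOnInterval.sub
      (f := fun t => g.toFun (g.dur - t)) (g := fun _ => g.endpoint)
      (acOn_comp_of_monotone_or_antitone g.ac (Or.inr ?_) ?_ ?_) (acOn_const _ _ _)
    · exact fun s t hst => by linarith
    · intro s t
      rw [dist_sub_left]
    · intro t ht
      rw [uIcc_of_le g.dur_nonneg, mem_Icc] at ht ⊢
      constructor <;> linarith

/-- The closed path `g_c`: `g` followed by the segment from `ĝ` back to the origin. -/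
noncomputable def closing (g : PlanarPath) : PlanarPath := g.concat (segment (-g.endpoint))

/-- The image of a path. -/
def image (g : PlanarPath) : Set (ℝ × ℝ) := g.toFun '' Icc 0 g.dur

/-- The integer `n` is the winding number of the closed path `c` around the point `z`: along `c`
there is a continuous determination `θ` of the polar angle seen from `z`, and its total
variation is `2πn` (so counterclockwise turns count positively). -/
def IsWindingNumber (c : PlanarPath) (z : ℝ × ℝ) (n : ℤ) : Prop :=
  ∃ r θ : ℝ → ℝ, ContinuousOn θ (Icc 0 c.dur) ∧
    (∀ t ∈ Icc 0 c.dur,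
      0 < r t ∧ c.toFun t = z + (r t * Real.cos (θ t), r t * Real.sin (θ t))) ∧
    θ c.dur - θ 0 = 2 * Real.pi * n

open Classical in
/-- The winding number `w_g(z)` of the closed path `g_c` around `z`, for `z` outside the image of
`g_c` (with value `0` where there is no winding number). -/
noncomputable def winding (g : PlanarPath) (z : ℝ × ℝ) : ℤ :=
  if h : ∃ n, g.closing.IsWindingNumber z n then h.choose else 0

/-- The algebraic area `A(g) = ∬ w_g(x,y) dx dy`. -/
noncomputable def area (g : PlanarPath) : ℝ :=
  ∫ z in g.closing.imageᶜ, (g.winding z : ℝ)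

/-- The weighted area `B_y(g) = ∬ y w_g(x,y) dx dy`. -/
noncomputable def bary (g : PlanarPath) : ℝ :=
  ∫ z in g.closing.imageᶜ, z.2 * (g.winding z : ℝ)

/-- Two paths are equivalent if they have the same endpoint, the same area `A` and the same
weighted area `B_y`. -/
instance equivalence : Setoid PlanarPath where
  r g h := g.endpoint = h.endpoint ∧ g.area = h.area ∧ g.bary = h.bary
  iseqv := ⟨fun _ => ⟨rfl, rfl, rfl⟩, fun h => ⟨h.1.symm, h.2.1.symm, h.2.2.symm⟩,
    fun h k => ⟨h.1.trans k.1, h.2.1.trans k.2.1, h.2.2.trans k.2.2⟩⟩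

end PlanarPath

/-- The determinant of two vectors of the plane. -/
def planarDet (u v : ℝ × ℝ) : ℝ := u.1 * v.2 - u.2 * v.1

/-- The set `Ē` of equivalence classes of paths. -/
def EngelBar : Type := Quotient PlanarPath.equivalence

/-- The equivalence class of a path. -/
def PlanarPath.toEngel (g : PlanarPath) : EngelBar := Quotient.mk PlanarPath.equivalence g

/-- The coordinates `(x_g, y_g, A(g), B_y(g))` of the class of `g`. -/
noncomputable def EngelBar.coords : EngelBar → ℝ × ℝ × ℝ × ℝ :=
  Quotient.lift (fun g : PlanarPath => (g.endpoint.1, g.endpoint.2, g.area, g.bary))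
    (fun g h hgh => by rw [hgh.1, hgh.2.1, hgh.2.2])

/-- The topology of `Ē` is the one given by the coordinates. -/
noncomputable instance : TopologicalSpace EngelBar :=
  TopologicalSpace.induced EngelBar.coords inferInstance

/-- The matrices of the standard linear model of the Engel group. -/
noncomputable def engelMatrix (a b c d : ℝ) : Matrix (Fin 4) (Fin 4) ℝ :=
  !![1, a, a ^ 2 / 2, d;
     0, 1, a, c;
     0, 0, 1, b;
     0, 0, 0, 1]

theorem engelMatrix_mul (a b c d a' b' c' d' : ℝ) :
    engelMatrix a b c d * engelMatrix a' b' c' d' =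
      engelMatrix (a + a') (b + b') (c' + a * b' + c) (d' + a * c' + a ^ 2 / 2 * b' + d) := by
  ext i j
  fin_cases i <;> fin_cases j <;>
    simp [engelMatrix, Matrix.mul_apply, Fin.sum_univ_four] <;> ring

theorem engelMatrix_zero : engelMatrix 0 0 0 0 = 1 := by
  ext i j
  fin_cases i <;> fin_cases j <;> simp [engelMatrix]

/-- The standard real Engel group, as a matrix group: the simply connected Lie group whose Lie
algebra has basis `X = E₁₂ + E₂₃`, `Y = E₃₄`, `[X, Y] = E₂₄`, `[X, [X, Y]] = E₁₄`, all other
brackets of basis vectors being zero. -/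
def engelMatrixGroup : Subgroup (GL (Fin 4) ℝ) where
  carrier := {M | ∃ a b c d : ℝ, (M : Matrix (Fin 4) (Fin 4) ℝ) = engelMatrix a b c d}
  mul_mem' := by
    rintro M N ⟨a, b, c, d, hM⟩ ⟨a', b', c', d', hN⟩
    exact ⟨_, _, _, _, by rw [Units.val_mul, hM, hN, engelMatrix_mul]⟩
  one_mem' := ⟨0, 0, 0, 0, by rw [engelMatrix_zero, Units.val_one]⟩
  inv_mem' := by
    rintro M ⟨a, b, c, d, hM⟩
    refine ⟨-a, -b, a * b - c, -d + a * c - a ^ 2 / 2 * b, ?_⟩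
    refine Units.inv_eq_of_mul_eq_one_right ?_
    rw [hM, engelMatrix_mul, ← engelMatrix_zero]
    congr 1 <;> ring

/-! Off the null set of the curves involved, 2π times the winding number is the angle swept by the
path plus the angle under which the closing segment is seen. Swept angles add under concatenation,
and a segment traversed backwards contributes the opposite angle. Comparing the closing segments of
g, h and gh, what remains is exactly the winding number of the triangle with vertices 0, ĝ, ĝ + ĥ,
so w_{gh}(z) = w_g(z) + w_h(z - ĝ) + w_triangle(z) almost everywhere (`winding_concat`). Integrating
this against 1 and y gives both product formulas, once the area and first moment of the triangle are
computed by a linear change of variables (`area_triangle`, `bary_triangle`).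

Integrability is a Banach indicatrix argument. The number of turns around z is bounded by the number
of steps of a fine subdivision in which the curve crosses the height of z; integrating over heights
bounds the count by the total variation, and Fatou's lemma concludes (`lintegral_winding_lt_top`).
Images are null because the paths have bounded variation (`volume_image`).

The rest is algebra. In the coordinates (x, y, A, B_y) the product and the inverse are polynomial
maps, so the group axioms, smoothness and the matrix representation are polynomial computations;
rectangles realise every value of the coordinates (`exists_coords`). -/

/-! ### Continuous arguments along curves in the punctured plane -/

/-- Along `f : [a, b] → ℂ \ {0}` there is a continuous determination of the argument, whose total
variation is `Δ`. -/
def HasAngle (f : ℝ → ℂ) (a b Δ : ℝ) : Prop :=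
  ∃ θ : ℝ → ℝ, ContinuousOn θ (Icc a b) ∧
    (∀ t ∈ Icc a b, f t ≠ 0 ∧ f t = ‖f t‖ * Complex.exp (θ t * Complex.I)) ∧ θ b - θ a = Δ

theorem Complex.exp_ofReal_mul_I_eq_iff {x y : ℝ} :
    Complex.exp (x * Complex.I) = Complex.exp (y * Complex.I) ↔
      ∃ n : ℤ, x = y + 2 * Real.pi * n := by
  rw [Complex.exp_eq_exp_iff_exists_int]
  refine exists_congr fun n => ?_
  constructor
  · intro h
    have := congrArg Complex.im h
    simp at this
    linarith
  · rintro rfl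
    push_cast
    ring

namespace HasAngle

variable {f g : ℝ → ℂ} {a b c Δ Δ' : ℝ}

theorem ne_zero (h : HasAngle f a b Δ) {t : ℝ} (ht : t ∈ Icc a b) : f t ≠ 0 := by
  obtain ⟨θ, -, h2, -⟩ := h
  exact (h2 t ht).1

/-- The curve, extended constantly to ℝ, lifts through the covering `Complex.exp`; the imaginary
part of the lift is the argument. -/
theorem exists_of_continuousOn (hab : a ≤ b) (hf : ContinuousOn f (Icc a b))
    (h0 : ∀ t ∈ Icc a b, f t ≠ 0) : ∃ Δ, HasAngle f a b Δ := by
  let F : C(ℝ, ℂ) := ⟨IccExtend hab ((Icc a b).domRestrict f),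
    (continuousOn_iff_continuous_domRestrict.1 hf).Icc_extend'⟩
  have hF : ∀ t, F t ≠ 0 := fun t => h0 _ (projIcc a b hab t).2
  obtain ⟨L, ⟨-, hL⟩, -⟩ := Complex.isCoveringMapOn_exp.existsUnique_continuousMap_lifts F
    (a₀ := a) (Complex.exp_log (hF a)) (fun t => hF t)
  refine ⟨_, fun t => (L t).im, (Complex.continuous_im.comp L.continuous).continuousOn,
    fun t ht => ⟨h0 t ht, ?_⟩, rfl⟩
  have h1 : Complex.exp (L t) = f t := by
    have := congrFun hL t
    simp only [Function.comp_apply] at this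
    rw [this]
    simp [F, IccExtend, projIcc_of_mem hab ht]
  rw [← h1, Complex.norm_exp, Complex.ofReal_exp, ← Complex.exp_add, Complex.re_add_im]

theorem exists_int_sub {θ θ' : ℝ} {z : ℂ} (h0 : z ≠ 0)
    (h : z = ‖z‖ * Complex.exp (θ * Complex.I)) (h' : z = ‖z‖ * Complex.exp (θ' * Complex.I)) :
    ∃ n : ℤ, θ = θ' + 2 * Real.pi * n := by
  rw [← Complex.exp_ofReal_mul_I_eq_iff]
  exact mul_left_cancel₀ (Complex.ofReal_ne_zero.2 (norm_ne_zero_iff.2 h0)) (h.symm.trans h')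

/-- Two determinations differ by 2π times a continuous integer-valued function, which is constant on
an interval. -/
theorem unique (hab : a ≤ b) (h : HasAngle f a b Δ) (h' : HasAngle f a b Δ') : Δ = Δ' := by
  obtain ⟨θ, h1, h2, rfl⟩ := h
  obtain ⟨θ', h1', h2', rfl⟩ := h'
  have hcont : ContinuousOn (fun t => (θ t - θ' t) / (2 * Real.pi)) (Icc a b) :=
    (h1.sub h1').div_const _
  have hint : MapsTo (fun t => (θ t - θ' t) / (2 * Real.pi)) (Icc a b)
      (range ((↑) : ℤ → ℝ)) := by
    intro t ht
    obtain ⟨n, hn⟩ := exists_int_sub (h2 t ht).1 (h2 t ht).2 (h2' t ht).2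
    exact ⟨n, by simp only [hn]; field_simp; ring⟩
  have hdisc : IsDiscrete (range ((↑) : ℤ → ℝ)) :=
    Int.isClosedEmbedding_coe_real.isEmbedding.isDiscrete_range
  have hD : (θ b - θ' b) / (2 * Real.pi) = (θ a - θ' a) / (2 * Real.pi) :=
    isPreconnected_Icc.constant_of_mapsTo hdisc hcont hint (right_mem_Icc.2 hab)
      (left_mem_Icc.2 hab)
  have hpi := Real.pi_ne_zero
  field_simp at hD
  linarith

theorem congr (h : HasAngle f a b Δ) (hfg : EqOn f g (Icc a b)) : HasAngle g a b Δ := by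
  obtain ⟨θ, h1, h2, h3⟩ := h
  exact ⟨θ, h1, fun t ht => hfg ht ▸ h2 t ht, h3⟩

/-- The variation of the argument is additive. -/
theorem split (hab : a ≤ b) (hbc : b ≤ c) (h : HasAngle f a c Δ) :
    ∃ Δ₁ Δ₂, HasAngle f a b Δ₁ ∧ HasAngle f b c Δ₂ ∧ Δ = Δ₁ + Δ₂ := by
  obtain ⟨θ, h1, h2, rfl⟩ := h
  exact ⟨θ b - θ a, θ c - θ b,
    ⟨θ, h1.mono (Icc_subset_Icc_right hbc), fun t ht => h2 t (Icc_subset_Icc_right hbc ht), rfl⟩,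
    ⟨θ, h1.mono (Icc_subset_Icc_left hab), fun t ht => h2 t (Icc_subset_Icc_left hab ht), rfl⟩,
    by ring⟩

theorem comp_add_right (h : HasAngle f a b Δ) (s : ℝ) :
    HasAngle (fun t => f (t + s)) (a - s) (b - s) Δ := by
  obtain ⟨θ, h1, h2, rfl⟩ := h
  have hm : MapsTo (fun t => t + s) (Icc (a - s) (b - s)) (Icc a b) :=
    fun t ht => ⟨by linarith [ht.1], by linarith [ht.2]⟩
  exact ⟨fun t => θ (t + s), h1.comp (by fun_prop) hm, fun t ht => h2 _ (hm ht), by simp⟩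

theorem comp_sub_left (h : HasAngle f a b Δ) (s : ℝ) :
    HasAngle (fun t => f (s - t)) (s - b) (s - a) (-Δ) := by
  obtain ⟨θ, h1, h2, rfl⟩ := h
  have hm : MapsTo (fun t => s - t) (Icc (s - b) (s - a)) (Icc a b) :=
    fun t ht => ⟨by linarith [ht.2], by linarith [ht.1]⟩
  exact ⟨fun t => θ (s - t), h1.comp (by fun_prop) hm, fun t ht => h2 _ (hm ht), by simp⟩

/-- If `g / f` avoids the negative real axis, the variations of the arguments of `f` and `g` are
related through the principal argument of `g / f`. -/
theorem of_div_mem_slitPlane (h : HasAngle f a b Δ) (hf : ContinuousOn f (Icc a b))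
    (hg : ContinuousOn g (Icc a b)) (hs : ∀ t ∈ Icc a b, g t / f t ∈ Complex.slitPlane) :
    HasAngle g a b (Δ + (Complex.arg (g b / f b) - Complex.arg (g a / f a))) := by
  obtain ⟨θ, h1, h2, rfl⟩ := h
  refine ⟨fun t => θ t + Complex.arg (g t / f t), h1.add ?_, fun t ht => ?_, by ring⟩
  · intro t ht
    exact (Complex.continuousAt_arg (hs t ht)).comp_continuousWithinAt (f := fun t => g t / f t)
      ((hg t ht).div (hf t ht) (h2 t ht).1)
  · obtain ⟨h0, hθ⟩ := h2 t ht
    have hq := Complex.slitPlane_ne_zero (hs t ht)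
    have hg0 : g t ≠ 0 := fun h => hq (by rw [h, zero_div])
    refine ⟨hg0, ?_⟩
    have e : g t = f t * (g t / f t) := by field_simp
    have e2 := Complex.norm_mul_exp_arg_mul_I (g t / f t)
    calc g t = f t * (g t / f t) := e
      _ = (‖f t‖ * Complex.exp (θ t * Complex.I)) *
          (‖g t / f t‖ * Complex.exp (Complex.arg (g t / f t) * Complex.I)) := by
        rw [← hθ, e2]
      _ = ‖f t * (g t / f t)‖ *
          Complex.exp ((θ t + Complex.arg (g t / f t) : ℝ) * Complex.I) := by
        rw [norm_mul]
        push_cast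
        rw [add_mul, Complex.exp_add]
        ring
      _ = _ := by rw [← e]

theorem const {z : ℂ} (hz : z ≠ 0) : HasAngle (fun _ => z) a b 0 :=
  ⟨fun _ => Complex.arg z, continuousOn_const,
    fun _ _ => ⟨hz, (Complex.norm_mul_exp_arg_mul_I z).symm⟩, by ring⟩

/-- The variation of the argument of a loop is an integral multiple of `2π`. -/
theorem exists_int (hab : a ≤ b) (h : HasAngle f a b Δ) (hf : f b = f a) :
    ∃ n : ℤ, Δ = 2 * Real.pi * n := by
  obtain ⟨θ, -, h2, rfl⟩ := h
  obtain ⟨h0, ha⟩ := h2 a (left_mem_Icc.2 hab)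
  obtain ⟨-, hb⟩ := h2 b (right_mem_Icc.2 hab)
  rw [hf] at hb
  obtain ⟨n, hn⟩ := exists_int_sub h0 hb ha
  exact ⟨n, by rw [hn]; ring⟩

/-- A loop staying closer to `f` than the distance from `f` to the origin turns like `f`. -/
theorem of_norm_sub_lt (h : HasAngle f a b Δ) (hf : ContinuousOn f (Icc a b))
    (hg : ContinuousOn g (Icc a b)) (hfab : f b = f a) (hgab : g b = g a)
    (hs : ∀ t ∈ Icc a b, ‖g t - f t‖ < ‖f t‖) : HasAngle g a b Δ := by
  have := h.of_div_mem_slitPlane hf hg fun t ht => by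
    have h0 := h.ne_zero ht
    have e : g t / f t = 1 + (g t - f t) / f t := by field_simp; ring
    rw [e]
    refine Complex.mem_slitPlane_of_norm_lt_one ?_
    rw [norm_div, div_lt_one (norm_pos_iff.2 h0)]
    exact hs t ht
  -- Both curves are closed, so the correction terms at the two ends cancel.
  simpa [hfab, hgab] using this

open Classical in
/-- The number of turns of a loop is at most the number of steps of a fine enough subdivision
during which the loop meets the real axis. -/
theorem eventually_abs_le_card {T : ℝ} (hT : 0 ≤ T) {n : ℤ}
    (h : HasAngle f 0 T (2 * Real.pi * n)) (hf : f T = f 0) :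
    ∀ᶠ N : ℕ in Filter.atTop, (|n| : ℤ) ≤
      (((Finset.range N).filter fun i : ℕ =>
        (0 : ℝ) ∈ uIcc (f (i * (T / N))).im (f ((i + 1 : ℕ) * (T / N))).im).card : ℤ) := by
  obtain ⟨θ, h1, h2, h3⟩ := h
  have huc := isCompact_Icc.uniformContinuousOn_of_continuous h1
  rw [Metric.uniformContinuousOn_iff] at huc
  obtain ⟨δ, hδ, huc⟩ := huc Real.pi Real.pi_pos
  have hlim : Filter.Tendsto (fun N : ℕ => T / N) Filter.atTop (nhds 0) :=
    tendsto_const_div_atTop_nhds_zero_nat T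
  filter_upwards [hlim.eventually (gt_mem_nhds hδ), Filter.eventually_gt_atTop 0] with N hN hN0
  have hNpos : (0 : ℝ) < N := Nat.cast_pos.2 hN0
  have hstep : 0 ≤ T / N := by positivity
  have hmem : ∀ i ≤ N, (i : ℝ) * (T / N) ∈ Icc 0 T := by
    intro i hi
    refine ⟨by positivity, ?_⟩
    have : (i : ℝ) ≤ N := Nat.cast_le.2 hi
    calc (i : ℝ) * (T / N) ≤ N * (T / N) := by gcongr
      _ = T := by field_simp
  have hlast : (N : ℝ) * (T / N) = T := by field_simp
  -- `m i` is the branch index at the i-th node; n is the telescoping sum of its increments, so it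
  -- suffices to bound each increment by 1, and by 0 when the real axis is not met.
  have hm : ∀ i, ∃ m : ℤ, i ≤ N →
      θ (i * (T / N)) = Complex.arg (f (i * (T / N))) + 2 * Real.pi * m := by
    intro i
    by_cases hi : i ≤ N
    · obtain ⟨h0, h4⟩ := h2 _ (hmem i hi)
      obtain ⟨m, hm⟩ := exists_int_sub h0 h4 (Complex.norm_mul_exp_arg_mul_I _).symm
      exact ⟨m, fun _ => hm⟩
    · exact ⟨0, fun h => absurd h hi⟩
  choose m hm using hm
  have hpi := Real.pi_pos
  have hn : n = m N - m 0 := by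
    have e1 := hm N le_rfl
    have e0 := hm 0 (Nat.zero_le _)
    simp only [hlast, Nat.cast_zero, zero_mul] at e0 e1
    rw [e1, e0, hf] at h3
    have : (n : ℝ) = m N - m 0 := by
      have : 2 * Real.pi * (m N - m 0 - n : ℝ) = 0 := by linarith
      have := (mul_eq_zero.1 this).resolve_left (by positivity)
      linarith
    exact_mod_cast this
  rw [hn, ← Finset.sum_range_sub, Finset.card_filter, Nat.cast_sum]
  refine (Finset.abs_sum_le_sum_abs _ _).trans (Finset.sum_le_sum fun i hi => ?_)
  have hi : i < N := Finset.mem_range.1 hi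
  have e0 := hm i hi.le
  have e1 := hm (i + 1) hi
  have hd : |θ ((i + 1 : ℕ) * (T / N)) - θ (i * (T / N))| < Real.pi := by
    rw [← Real.dist_eq]
    refine huc _ (hmem _ hi) _ (hmem _ hi.le) ?_
    rw [Real.dist_eq, ← sub_mul]
    push_cast
    rw [add_sub_cancel_left, one_mul, abs_of_nonneg hstep]
    exact hN
  set u := f (i * (T / N))
  -- By uniform continuity θ moves by less than π in one step, so 2π times the branch jump is less
  -- than π plus the change of the principal argument.
  set v := f ((i + 1 : ℕ) * (T / N))
  rw [e0, e1, abs_lt] at hd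
  have key : ∀ K : ℤ, |Complex.arg v - Complex.arg u| < Real.pi * (2 * K - 1) →
      |m (i + 1) - m i| < K := by
    intro K hK
    rw [abs_lt] at hK
    have : |(m (i + 1) - m i : ℝ)| < K := by
      rw [abs_lt]
      constructor
      · have : 2 * Real.pi * -K < 2 * Real.pi * (m (i + 1) - m i) := by linarith
        exact lt_of_mul_lt_mul_left this (by positivity)
      · have : 2 * Real.pi * (m (i + 1) - m i) < 2 * Real.pi * K := by linarith
        exact lt_of_mul_lt_mul_left this (by positivity)
    exact_mod_cast this
  have au := Complex.arg_mem_Ioc u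
  have av := Complex.arg_mem_Ioc v
  split_ifs with hc
  · rw [Nat.cast_one]
    refine Int.lt_add_one_iff.1 (key (1 + 1) ?_)
    rw [abs_lt]
    push_cast
    constructor <;> linarith [au.1, au.2, av.1, av.2]
  -- Both ends lie strictly on the same side of the real axis, where principal arguments differ by
  -- less than π.
  · rw [Nat.cast_zero]
    refine Int.lt_add_one_iff.1 (key (0 + 1) ?_)
    rw [abs_lt]
    push_cast
    rw [mem_uIcc, not_or, not_and_or, not_and_or, not_le, not_le, not_le, not_le] at hc
    have hsign : (0 < u.im ∧ 0 < v.im) ∨ (u.im < 0 ∧ v.im < 0) := by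
      rcases hc with ⟨h1 | h1, h2 | h2⟩
      · exact Or.inl ⟨h1, h2⟩
      · linarith
      · linarith
      · exact Or.inr ⟨h2, h1⟩
    rcases hsign with ⟨hu, hv⟩ | ⟨hu, hv⟩
    · have a1 : 0 < u.arg := lt_of_le_of_ne (Complex.arg_nonneg_iff.2 hu.le)
        fun h => hu.ne' (by rw [← Complex.norm_mul_sin_arg, ← h]; simp)
      have a2 : 0 < v.arg := lt_of_le_of_ne (Complex.arg_nonneg_iff.2 hv.le)
        fun h => hv.ne' (by rw [← Complex.norm_mul_sin_arg, ← h]; simp)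
      constructor <;> linarith [au.2, av.2]
    · have a1 := Complex.arg_neg_iff.2 hu
      have a2 := Complex.arg_neg_iff.2 hv
      constructor <;> linarith [au.1, av.1]

end HasAngle

/-! ### Images of paths are null sets -/

/-- The identification of `ℝ²` with the complex plane. -/
noncomputable def planeToComplex : ℝ × ℝ →L[ℝ] ℂ := Complex.equivRealProdCLM.symm

@[simp] theorem planeToComplex_re (p : ℝ × ℝ) : (planeToComplex p).re = p.1 := by
  simp [planeToComplex]

@[simp] theorem planeToComplex_im (p : ℝ × ℝ) : (planeToComplex p).im = p.2 := by
  simp [planeToComplex]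

theorem planeToComplex_eq_zero {p : ℝ × ℝ} : planeToComplex p = 0 ↔ p = 0 := by
  simp [Complex.ext_iff, Prod.ext_iff]

namespace PlanarPath

theorem continuousOn (g : PlanarPath) : ContinuousOn g.toFun (Icc 0 g.dur) := by
  have := g.ac.continuousOn
  rwa [uIcc_of_le g.dur_nonneg] at this

theorem isCompact_image (g : PlanarPath) : IsCompact g.image :=
  isCompact_Icc.image_of_continuousOn g.continuousOn

theorem variation_ne_top (g : PlanarPath) : eVariationOn g.toFun (Icc 0 g.dur) ≠ ⊤ := by
  have := g.ac.boundedVariationOn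
  rwa [uIcc_of_le g.dur_nonneg] at this

theorem monotone_subdivision {T : ℝ} (hT : 0 ≤ T) (N : ℕ) :
    Monotone fun i : ℕ => (i : ℝ) * (T / N) := by
  intro i j hij
  have : (i : ℝ) ≤ j := Nat.cast_le.2 hij
  have : 0 ≤ T / N := by positivity
  dsimp only
  gcongr

theorem sum_variation_subdivision (g : PlanarPath) {N : ℕ} (hN : N ≠ 0) :
    ∑ i ∈ Finset.range N, eVariationOn g.toFun
      (Icc (i * (g.dur / N)) ((i + 1 : ℕ) * (g.dur / N))) =
        eVariationOn g.toFun (Icc 0 g.dur) := by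
  have := eVariationOn.sum' g.toFun (monotone_subdivision g.dur_nonneg N) (n := N)
  have hN' : (N : ℝ) ≠ 0 := Nat.cast_ne_zero.2 hN
  rwa [Nat.cast_zero, zero_mul, mul_div_cancel₀ _ hN'] at this

theorem exists_mem_subdivision {T t : ℝ} {N : ℕ} (hN : N ≠ 0) (ht : t ∈ Icc 0 T) :
    ∃ i < N, t ∈ Icc (i * (T / N)) ((i + 1 : ℕ) * (T / N)) := by
  have hN' : (N : ℝ) ≠ 0 := Nat.cast_ne_zero.2 hN
  by_contra! hcon
  have : ∀ i ≤ N, (i : ℝ) * (T / N) ≤ t := by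
    intro i
    induction i with
    | zero => intro _; simpa using ht.1
    | succ i ih =>
      intro hi
      by_contra hlt
      exact hcon i hi ⟨ih (Nat.le_of_succ_le hi), (not_le.1 hlt).le⟩
  obtain ⟨M, rfl⟩ := Nat.exists_eq_succ_of_ne_zero hN
  refine hcon M (Nat.lt_succ_self M) ⟨this M (Nat.le_succ M), ?_⟩
  have e : ((M + 1 : ℕ) : ℝ) * (T / (M + 1 : ℕ)) = T := mul_div_cancel₀ _ hN'
  exact ht.2.trans e.ge

/-- The image of an absolutely continuous path has measure zero. -/
theorem volume_image (g : PlanarPath) : volume g.image = 0 := by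
  set V := eVariationOn g.toFun (Icc 0 g.dur) with hV
  have key : ∀ ε : NNReal, 0 < ε → volume g.image ≤ 4 * ε * V := by
    intro ε hε
    have huc := isCompact_Icc.uniformContinuousOn_of_continuous g.continuousOn
    rw [EMetric.uniformContinuousOn_iff] at huc
    obtain ⟨δ, hδ, huc⟩ := huc ε (by simpa using hε)
    obtain ⟨δ', hδ'0, hδ'⟩ := ENNReal.lt_iff_exists_real_btwn.1 hδ
    have hδ'pos : 0 < δ' := ENNReal.ofReal_pos.1 hδ'.1
    have hlim : Filter.Tendsto (fun N : ℕ => g.dur / N) Filter.atTop (nhds 0) :=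
      tendsto_const_div_atTop_nhds_zero_nat _
    obtain ⟨N, hN, hN0⟩ :=
      ((hlim.eventually (gt_mem_nhds hδ'pos)).and (Filter.eventually_ne_atTop 0)).exists
    have hN' : (N : ℝ) ≠ 0 := Nat.cast_ne_zero.2 hN0
    let a : ℕ → ℝ := fun i => i * (g.dur / N)
    -- Each piece lies in a square of half-side `v i`. In the area 4 (v i)², one factor is bounded
    -- by ε and the other by the variation of the piece, and the variations add up to V.
    let v : ℕ → ENNReal := fun i => min ε (eVariationOn g.toFun (Icc (a i) (a (i + 1))))
    have hmono := monotone_subdivision g.dur_nonneg N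
    have ha0 : a 0 = 0 := by simp [a]
    have haN : a N = g.dur := mul_div_cancel₀ _ hN'
    have hsub : g.image ⊆ ⋃ i ∈ Finset.range N,
        Metric.closedEBall (g.toFun (a i)).1 (v i) ×ˢ
          Metric.closedEBall (g.toFun (a i)).2 (v i) := by
      rintro _ ⟨t, ht, rfl⟩
      obtain ⟨i, hi, hti⟩ := exists_mem_subdivision hN0 ht
      have hi0 : a i ∈ Icc (a i) (a (i + 1)) := left_mem_Icc.2 (hmono (Nat.le_succ i))
      have hi1 : a i ∈ Icc 0 g.dur := ⟨ha0 ▸ hmono (Nat.zero_le i), haN ▸ hmono hi.le⟩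
      have hd : edist (g.toFun t) (g.toFun (a i)) ≤ v i := by
        refine le_min (huc ht hi1 ?_).le (eVariationOn.edist_le _ hti hi0)
        refine lt_of_le_of_lt ?_ hδ'.2
        rw [edist_dist, Real.dist_eq]
        refine ENNReal.ofReal_le_ofReal ?_
        have h1 : a i ≤ t := hti.1
        have h2 : t ≤ (i + 1 : ℕ) * (g.dur / N) := hti.2
        rw [abs_of_nonneg (sub_nonneg.2 h1)]
        push_cast at h2
        simp only [a]
        linarith
      simp only [mem_iUnion, Finset.mem_range]
      rw [Prod.edist_eq] at hd
      exact ⟨i, hi, (le_max_left _ _).trans hd, (le_max_right _ _).trans hd⟩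
    calc volume g.image ≤ ∑ i ∈ Finset.range N,
          volume (Metric.closedEBall (g.toFun (a i)).1 (v i) ×ˢ
            Metric.closedEBall (g.toFun (a i)).2 (v i)) :=
          (measure_mono hsub).trans (measure_biUnion_finset_le _ _)
      _ ≤ ∑ i ∈ Finset.range N, 4 * ε * eVariationOn g.toFun (Icc (a i) (a (i + 1))) := by
        refine Finset.sum_le_sum fun i _ => ?_
        rw [Measure.volume_eq_prod, Measure.prod_prod, Real.volume_closedEBall,
          Real.volume_closedEBall]
        calc 2 * v i * (2 * v i) = 4 * v i * v i := by ring
          _ ≤ _ := by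
            gcongr
            · exact min_le_left _ _
            · exact min_le_right _ _
      _ = 4 * ε * V := by
        rw [← Finset.mul_sum, sum_variation_subdivision g hN0]
  have hlim : Filter.Tendsto (fun n : ℕ => 4 * (((1 / (n + 1 : NNReal) : NNReal)) : ENNReal) * V)
      Filter.atTop (nhds (4 * ((0 : NNReal) : ENNReal) * V)) := by
    refine ENNReal.Tendsto.mul_const (ENNReal.Tendsto.const_mul ?_ (Or.inr (by simp)))
      (Or.inr g.variation_ne_top)
    rw [ENNReal.tendsto_coe]
    exact tendsto_one_div_add_atTop_nhds_zero_nat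
  simp only [ENNReal.coe_zero, mul_zero, zero_mul] at hlim
  exact le_antisymm (ge_of_tendsto' hlim fun n => key _ (by positivity)) zero_le

theorem ae_notMem_image (g : PlanarPath) : ∀ᵐ z, z ∉ g.image :=
  measure_eq_zero_iff_ae_notMem.1 g.volume_image

theorem ae_sub_notMem_image (g : PlanarPath) (v : ℝ × ℝ) : ∀ᵐ z, z - v ∉ g.image :=
  (measurePreserving_sub_right volume v).quasiMeasurePreserving.ae g.ae_notMem_image

/-! ### Swept angles and winding numbers -/

/-- The path `g` seen from the point `z`, as a function with complex values. -/
noncomputable def rel (g : PlanarPath) (z : ℝ × ℝ) (t : ℝ) : ℂ := planeToComplex (g.toFun t - z)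

theorem continuousOn_rel (g : PlanarPath) (z : ℝ × ℝ) :
    ContinuousOn (g.rel z) (Icc 0 g.dur) :=
  planeToComplex.continuous.comp_continuousOn (g.continuousOn.sub continuousOn_const)

theorem rel_ne_zero {g : PlanarPath} {z : ℝ × ℝ} (hz : z ∉ g.image) {t : ℝ}
    (ht : t ∈ Icc 0 g.dur) : g.rel z t ≠ 0 := by
  rw [rel, Ne, planeToComplex_eq_zero, sub_eq_zero]
  exact fun h => hz ⟨t, ht, h⟩

theorem exists_hasAngle {g : PlanarPath} {z : ℝ × ℝ} (hz : z ∉ g.image) :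
    ∃ Δ, HasAngle (g.rel z) 0 g.dur Δ :=
  HasAngle.exists_of_continuousOn g.dur_nonneg (g.continuousOn_rel z) fun _ => rel_ne_zero hz

open Classical in
/-- The angle swept by the path `g` as seen from `z`. -/
noncomputable def angle (g : PlanarPath) (z : ℝ × ℝ) : ℝ :=
  if h : ∃ Δ, HasAngle (g.rel z) 0 g.dur Δ then h.choose else 0

theorem hasAngle {g : PlanarPath} {z : ℝ × ℝ} (hz : z ∉ g.image) :
    HasAngle (g.rel z) 0 g.dur (g.angle z) := by
  rw [angle, dif_pos (exists_hasAngle hz)]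
  exact (exists_hasAngle hz).choose_spec

theorem angle_eq {g : PlanarPath} {z : ℝ × ℝ} (hz : z ∉ g.image) {Δ : ℝ}
    (h : HasAngle (g.rel z) 0 g.dur Δ) : g.angle z = Δ :=
  (hasAngle hz).unique g.dur_nonneg h

/-- The radius in the definition is forced to be the modulus, so only the angle carries information.
-/
theorem isWindingNumber_iff {g : PlanarPath} {z : ℝ × ℝ} {n : ℤ} :
    g.IsWindingNumber z n ↔ HasAngle (g.rel z) 0 g.dur (2 * Real.pi * n) := by
  constructor
  · rintro ⟨r, θ, h1, h2, h3⟩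
    refine ⟨θ, h1, fun t ht => ?_, h3⟩
    obtain ⟨hr, he⟩ := h2 t ht
    have e : g.rel z t = r t * Complex.exp (θ t * Complex.I) := by
      rw [rel, he, add_sub_cancel_left]
      apply Complex.ext <;> simp [Complex.exp_re, Complex.exp_im]
    have hn : ‖g.rel z t‖ = r t := by
      rw [e, norm_mul, Complex.norm_exp_ofReal_mul_I, mul_one, Complex.norm_real, Real.norm_eq_abs,
        abs_of_pos hr]
    refine ⟨norm_pos_iff.1 (hn ▸ hr), ?_⟩
    rw [hn, e]
  · rintro ⟨θ, h1, h2, h3⟩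
    refine ⟨fun t => ‖g.rel z t‖, θ, h1, fun t ht => ?_, h3⟩
    obtain ⟨h0, he⟩ := h2 t ht
    refine ⟨norm_pos_iff.2 h0, ?_⟩
    rw [← sub_eq_iff_eq_add']
    have hre := congrArg Complex.re he
    have him := congrArg Complex.im he
    rw [Complex.re_ofReal_mul, Complex.exp_ofReal_mul_I_re] at hre
    rw [Complex.im_ofReal_mul, Complex.exp_ofReal_mul_I_im] at him
    ext
    · rw [← hre]; simp [rel]
    · rw [← him]; simp [rel]

theorem rel_dur_of_closed {g : PlanarPath} (hg : g.endpoint = 0) (z : ℝ × ℝ) :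
    g.rel z g.dur = g.rel z 0 := by
  rw [rel, rel, g.start]
  exact congrArg (fun p => planeToComplex (p - z)) hg

theorem existsUnique_isWindingNumber {g : PlanarPath} (hg : g.endpoint = 0) {z : ℝ × ℝ}
    (hz : z ∉ g.image) : ∃! n : ℤ, g.IsWindingNumber z n := by
  obtain ⟨n, hn⟩ := (hasAngle hz).exists_int g.dur_nonneg (rel_dur_of_closed hg z)
  refine ⟨n, isWindingNumber_iff.2 (hn ▸ hasAngle hz), fun m hm => ?_⟩
  have := (isWindingNumber_iff.1 hm).unique g.dur_nonneg (hasAngle hz)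
  rw [hn] at this
  exact_mod_cast mul_left_cancel₀ (by positivity) this

@[simp] theorem endpoint_segment (v : ℝ × ℝ) : (segment v).endpoint = v := one_smul ℝ v

@[simp] theorem dur_concat (g h : PlanarPath) : (g.concat h).dur = g.dur + h.dur := rfl

theorem concat_apply_of_le {g h : PlanarPath} {t : ℝ} (ht : t ≤ g.dur) :
    (g.concat h).toFun t = g.toFun t := if_pos ht

theorem concat_apply_of_ge {g h : PlanarPath} {t : ℝ} (ht : g.dur ≤ t) :
    (g.concat h).toFun t = g.endpoint + h.toFun (t - g.dur) := by
  rcases ht.eq_or_lt with rfl | ht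
  · rw [concat_apply_of_le le_rfl, sub_self, h.start, add_zero]; rfl
  · exact if_neg ht.not_ge

@[simp] theorem endpoint_concat (g h : PlanarPath) :
    (g.concat h).endpoint = g.endpoint + h.endpoint := by
  have := concat_apply_of_ge (g := g) (h := h) (t := g.dur + h.dur) (by linarith [h.dur_nonneg])
  rwa [add_sub_cancel_left] at this

@[simp] theorem endpoint_closing (g : PlanarPath) : g.closing.endpoint = 0 := by
  simp [closing]

theorem mem_image_concat {g h : PlanarPath} {z : ℝ × ℝ} :
    z ∈ (g.concat h).image ↔ z ∈ g.image ∨ z - g.endpoint ∈ h.image := by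
  have hg := g.dur_nonneg
  have hh := h.dur_nonneg
  constructor
  · rintro ⟨t, ht, rfl⟩
    rw [dur_concat] at ht
    rcases le_total t g.dur with h1 | h1
    · exact Or.inl ⟨t, ⟨ht.1, h1⟩, (concat_apply_of_le h1).symm⟩
    · refine Or.inr ⟨t - g.dur, ⟨by linarith, by linarith [ht.2]⟩, ?_⟩
      rw [concat_apply_of_ge h1, add_sub_cancel_left]
  · rintro (⟨t, ht, rfl⟩ | ⟨t, ht, he⟩)
    · exact ⟨t, ⟨ht.1, by rw [dur_concat]; linarith [ht.2]⟩, concat_apply_of_le ht.2⟩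
    · refine ⟨t + g.dur, ⟨by linarith [ht.1], by rw [dur_concat]; linarith [ht.2]⟩, ?_⟩
      rw [concat_apply_of_ge (by linarith [ht.1]), add_sub_cancel_right, he, add_sub_cancel]

theorem angle_concat {g h : PlanarPath} {z : ℝ × ℝ} (hz : z ∉ (g.concat h).image) :
    (g.concat h).angle z = g.angle z + h.angle (z - g.endpoint) := by
  have hg := g.dur_nonneg
  have hh := h.dur_nonneg
  have hz' := hz
  rw [mem_image_concat, not_or] at hz'
  obtain ⟨Δ₁, Δ₂, h1, h2, h3⟩ := (hasAngle hz).split hg (by rw [dur_concat]; linarith)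
  rw [h3, angle_eq hz'.1 (h1.congr fun t ht => by rw [rel, rel, concat_apply_of_le ht.2]),
    angle_eq hz'.2 (Δ := Δ₂)]
  have := h2.comp_add_right g.dur
  rw [sub_self, dur_concat, add_sub_cancel_left] at this
  refine this.congr fun t ht => ?_
  change planeToComplex ((g.concat h).toFun (t + g.dur) - z) = planeToComplex _
  rw [concat_apply_of_ge (by linarith [ht.1]), add_sub_cancel_right]
  congr 1
  abel

/-- The angle under which the segment `[p, q]` is seen from `z`. -/
noncomputable def segmentAngle (z p q : ℝ × ℝ) : ℝ :=
  Complex.arg (planeToComplex (q - z) / planeToComplex (p - z))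

/-- If the quotient were -s with s ≥ 0, then v = (1 + s) z and z would lie on the segment. -/
theorem div_mem_slitPlane {z v : ℝ × ℝ} (hz : z ∉ (segment v).image) :
    planeToComplex (v - z) / planeToComplex (0 - z) ∈ Complex.slitPlane := by
  by_contra hcon
  have h0 : planeToComplex (0 - z) ≠ 0 := by
    rw [Ne, planeToComplex_eq_zero, sub_eq_zero]
    exact fun h => hz ⟨0, by simp [segment], by rw [← h]; exact zero_smul ℝ v⟩
  rw [Complex.mem_slitPlane_iff_not_le_zero, not_not] at hcon
  obtain ⟨s, hs, he⟩ : ∃ s : ℝ, 0 ≤ s ∧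
      planeToComplex (v - z) / planeToComplex (0 - z) = ((-s : ℝ) : ℂ) := by
    rw [Complex.le_def] at hcon
    exact ⟨-(planeToComplex (v - z) / planeToComplex (0 - z)).re, by simpa using hcon.1,
      Complex.ext (by simp) (by simpa using hcon.2)⟩
  rw [div_eq_iff h0] at he
  have h1 := congrArg Complex.re he
  have h2 := congrArg Complex.im he
  rw [Complex.re_ofReal_mul] at h1
  rw [Complex.im_ofReal_mul] at h2
  simp at h1 h2
  refine hz ⟨1 / (1 + s), ⟨by positivity, ?_⟩, ?_⟩
  · change 1 / (1 + s) ≤ 1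
    rw [div_le_one (by positivity)]
    linarith
  · change (1 / (1 + s)) • v = z
    have : 1 + s ≠ 0 := by positivity
    ext
    · simp only [Prod.smul_fst, smul_eq_mul]; field_simp; linarith
    · simp only [Prod.smul_snd, smul_eq_mul]; field_simp; linarith

/-- Divided by its initial value, the moving vector runs straight from 1 to a point of the slit
plane. The slit plane is star-shaped about 1, so the principal argument is continuous along the way.
-/
theorem angle_segment {z v : ℝ × ℝ} (hz : z ∉ (segment v).image) :
    (segment v).angle z = segmentAngle z 0 v := by
  refine angle_eq hz ?_
  have h0 : planeToComplex (0 - z) ≠ 0 := by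
    rw [Ne, planeToComplex_eq_zero, sub_eq_zero]
    exact fun h => hz ⟨0, by simp [segment], by rw [← h]; exact zero_smul ℝ v⟩
  have hrel : ∀ t, (segment v).rel z t / planeToComplex (0 - z) =
      1 + t • (planeToComplex (v - z) / planeToComplex (0 - z) - 1) := by
    intro t
    have : (segment v).rel z t = planeToComplex (0 - z) +
        t • (planeToComplex (v - z) - planeToComplex (0 - z)) := by
      rw [rel, ← map_sub, ← map_smul, ← map_add]
      change planeToComplex (t • v - z) = _
      congr 1
      rw [sub_sub_sub_cancel_right, sub_zero]
      abel
    rw [this, Complex.real_smul, Complex.real_smul]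
    field_simp
  have := (HasAngle.const (a := 0) (b := (segment v).dur) h0).of_div_mem_slitPlane
    continuousOn_const ((segment v).continuousOn_rel z) fun t ht => by
      rw [hrel]
      refine Complex.starConvex_one_slitPlane.add_smul_mem ?_ ht.1 ht.2
      rw [add_sub_cancel]
      exact div_mem_slitPlane hz
  convert this using 1
  rw [rel, rel, (segment v).start, div_self h0, Complex.arg_one]
  change segmentAngle z 0 v = 0 + (Complex.arg (planeToComplex ((1 : ℝ) • v - z) / _) - 0)
  rw [one_smul, zero_add, sub_zero]
  rfl

theorem two_pi_mul_winding {g : PlanarPath} {z : ℝ × ℝ} (hz : z ∉ g.closing.image) :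
    2 * Real.pi * g.winding z = g.closing.angle z := by
  have h := (existsUnique_isWindingNumber (endpoint_closing g) hz).exists
  rw [winding, dif_pos h]
  exact (angle_eq hz (isWindingNumber_iff.1 h.choose_spec)).symm

end PlanarPath

/-! ### Integrability of the winding number -/

namespace PlanarPath

theorem winding_eq_of_hasAngle {g : PlanarPath} {z : ℝ × ℝ} {n : ℤ}
    (h : HasAngle (g.closing.rel z) 0 g.closing.dur (2 * Real.pi * n)) (hz : z ∉ g.closing.image) :
    g.winding z = n := by
  have := two_pi_mul_winding hz
  rw [angle_eq hz h] at this
  exact_mod_cast mul_left_cancel₀ (by positivity) this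

theorem hasAngle_winding {g : PlanarPath} {z : ℝ × ℝ} (hz : z ∉ g.closing.image) :
    HasAngle (g.closing.rel z) 0 g.closing.dur (2 * Real.pi * g.winding z) :=
  two_pi_mul_winding hz ▸ hasAngle hz

theorem rel_sub_rel (g : PlanarPath) (z z' : ℝ × ℝ) (t : ℝ) :
    g.rel z t - g.rel z' t = planeToComplex (z' - z) := by
  rw [rel, rel, ← map_sub, sub_sub_sub_cancel_left]

/-- The winding number is locally constant: moving z by less than its distance to the curve perturbs
the loop by less than its modulus. This gives measurability. -/
theorem continuousOn_winding (g : PlanarPath) :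
    ContinuousOn (fun z => (g.winding z : ℝ)) g.closing.imageᶜ := by
  intro z₀ hz₀
  have hU := g.closing.isCompact_image.isClosed.isOpen_compl
  obtain ⟨t₀, ht₀, hmin⟩ := (isCompact_Icc (a := 0) (b := g.closing.dur)).exists_isMinOn
    ⟨0, left_mem_Icc.2 g.closing.dur_nonneg⟩ (g.closing.continuousOn_rel z₀).norm
  have hpos := norm_pos_iff.2 (rel_ne_zero hz₀ ht₀)
  have hnear : ∀ᶠ z in nhds z₀, ‖planeToComplex (z₀ - z)‖ < ‖g.closing.rel z₀ t₀‖ := by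
    have hc : Continuous fun z => ‖planeToComplex (z₀ - z)‖ := by fun_prop
    refine hc.continuousAt.eventually_lt continuousAt_const ?_
    simpa using hpos
  have hloc : (fun z => (g.winding z : ℝ)) =ᶠ[nhds z₀] fun _ => (g.winding z₀ : ℝ) := by
    filter_upwards [hnear, hU.mem_nhds hz₀] with z hz hzU
    rw [winding_eq_of_hasAngle ?_ hzU]
    refine (hasAngle_winding hz₀).of_norm_sub_lt (g.closing.continuousOn_rel _)
      (g.closing.continuousOn_rel _) (rel_dur_of_closed g.endpoint_closing _)
      (rel_dur_of_closed g.endpoint_closing _) fun t ht => ?_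
    rw [rel_sub_rel]
    exact hz.trans_le (hmin ht)
  exact (continuousAt_const.congr hloc.symm).continuousWithinAt

/-- From far away, the loop seen from z is a small perturbation of the constant loop -z. -/
theorem exists_winding_eq_zero (g : PlanarPath) : ∃ R : ℝ, ∀ z ∉ g.closing.image,
    R < ‖planeToComplex z‖ → g.winding z = 0 := by
  obtain ⟨R, hR⟩ := isCompact_Icc.exists_bound_of_continuousOn (g.closing.continuousOn_rel 0)
  refine ⟨R, fun z hz hRz => winding_eq_of_hasAngle ?_ hz⟩
  have h0 : -planeToComplex z ≠ 0 := by
    rw [neg_ne_zero, ← norm_pos_iff]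
    exact lt_of_le_of_lt ((norm_nonneg _).trans
      (hR 0 (left_mem_Icc.2 g.closing.dur_nonneg))) hRz
  have hc := HasAngle.const (a := 0) (b := g.closing.dur) h0
  rw [Int.cast_zero, mul_zero]
  refine hc.of_norm_sub_lt continuousOn_const (g.closing.continuousOn_rel _) rfl
    (rel_dur_of_closed g.endpoint_closing _) fun t ht => ?_
  rw [sub_neg_eq_add, norm_neg]
  have : g.closing.rel z t + planeToComplex z = g.closing.rel 0 t := by
    rw [rel, rel, ← map_add, sub_add_cancel, sub_zero]
  rw [this]
  exact (hR t ht).trans_lt hRz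

open Classical in
theorem eventually_abs_winding_le (g : PlanarPath) {z : ℝ × ℝ} (hz : z ∉ g.closing.image) :
    ∀ᶠ N : ℕ in Filter.atTop, (|g.winding z| : ℤ) ≤
      (((Finset.range N).filter fun i : ℕ =>
        z.2 ∈ uIcc (g.closing.toFun (i * (g.closing.dur / N))).2
          (g.closing.toFun ((i + 1 : ℕ) * (g.closing.dur / N))).2).card : ℤ) := by
  have := HasAngle.eventually_abs_le_card g.closing.dur_nonneg (hasAngle_winding hz)
    (rel_dur_of_closed g.endpoint_closing _)
  filter_upwards [this] with N hN
  simpa only [rel, planeToComplex_im, Prod.snd_sub, mem_uIcc, sub_nonneg, sub_nonpos] using hN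

theorem abs_re_le_norm (z : ℝ × ℝ) : |z.1| ≤ ‖planeToComplex z‖ := by
  simpa using Complex.abs_re_le_norm (planeToComplex z)

theorem abs_im_le_norm (z : ℝ × ℝ) : |z.2| ≤ ‖planeToComplex z‖ := by
  simpa using Complex.abs_im_le_norm (planeToComplex z)

/-- For fixed N, `F N` counts the horizontal strips, swept by the steps of the subdivision, that
contain z. Its integral is at most 2R times the variation. The bound of |w| by `F N` holds only for
N large depending on z, hence the liminf and Fatou's lemma. -/
theorem lintegral_winding_lt_top (g : PlanarPath) :
    ∫⁻ z in g.closing.imageᶜ, ‖(g.winding z : ℝ)‖ₑ < ⊤ := by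
  classical
  obtain ⟨R, hR⟩ := g.exists_winding_eq_zero
  set c := g.closing with hc
  let S : ℕ → ℕ → Set (ℝ × ℝ) := fun N i => Icc (-R) R ×ˢ
    uIcc (c.toFun (i * (c.dur / N))).2 (c.toFun ((i + 1 : ℕ) * (c.dur / N))).2
  have hS : ∀ N i, MeasurableSet (S N i) := fun N i => measurableSet_Icc.prod measurableSet_uIcc
  let F : ℕ → ℝ × ℝ → ENNReal := fun N z => ∑ i ∈ Finset.range N, (S N i).indicator 1 z
  have hF : ∀ N, Measurable (F N) := fun N =>
    Finset.measurable_sum _ fun i _ => measurable_one.indicator (hS N i)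
  have hbound : ∀ N ≠ 0, ∫⁻ z, F N z ≤
      ENNReal.ofReal (2 * R) * eVariationOn c.toFun (Icc 0 c.dur) := by
    intro N hN
    rw [lintegral_finsetSum _ fun i _ => measurable_one.indicator (hS N i),
      ← sum_variation_subdivision c hN, Finset.mul_sum]
    refine Finset.sum_le_sum fun i _ => ?_
    rw [lintegral_indicator_one (hS N i), Measure.volume_eq_prod, Measure.prod_prod,
      Real.volume_Icc, Real.volume_interval, sub_neg_eq_add, ← two_mul]
    gcongr
    have hle := monotone_subdivision c.dur_nonneg N (Nat.le_succ i)
    refine le_trans ?_ (eVariationOn.edist_le c.toFun (right_mem_Icc.2 hle) (left_mem_Icc.2 hle))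
    rw [Prod.edist_eq, ← Real.dist_eq, ← edist_dist]
    exact le_max_right _ _
  calc ∫⁻ z in c.imageᶜ, ‖(g.winding z : ℝ)‖ₑ
      ≤ ∫⁻ z in c.imageᶜ, Filter.liminf (fun N => F N z) Filter.atTop := by
        refine setLIntegral_mono' c.isCompact_image.isClosed.isOpen_compl.measurableSet
          fun z hz => ?_
        by_cases hzR : R < ‖planeToComplex z‖
        · simp [hR z hz hzR]
        refine Filter.le_liminf_of_le (by isBoundedDefault) ?_
        filter_upwards [g.eventually_abs_winding_le hz] with N hN
        have hx : z.1 ∈ Icc (-R) R := abs_le.1 ((abs_re_le_norm z).trans (not_lt.1 hzR))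
        have e : F N z = (((Finset.range N).filter fun i : ℕ =>
            z.2 ∈ uIcc (c.toFun (i * (c.dur / N))).2
              (c.toFun ((i + 1 : ℕ) * (c.dur / N))).2).card : ENNReal) := by
          rw [Finset.card_filter]
          push_cast
          refine Finset.sum_congr rfl fun i _ => ?_
          simp only [indicator_apply, S, mem_prod, hx, true_and, Pi.one_apply]
          push_cast
          rfl
        rw [e, enorm_eq_nnnorm, ← ENNReal.coe_natCast, ENNReal.coe_le_coe, ← NNReal.coe_le_coe,
          coe_nnnorm, Real.norm_eq_abs, NNReal.coe_natCast, ← Int.cast_abs, ← Int.cast_natCast,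
          Int.cast_le]
        exact hN
    _ ≤ ∫⁻ z, Filter.liminf (fun N => F N z) Filter.atTop := setLIntegral_le_lintegral _ _
    _ ≤ Filter.liminf (fun N => ∫⁻ z, F N z) Filter.atTop := lintegral_liminf_le hF
    _ ≤ ENNReal.ofReal (2 * R) * eVariationOn c.toFun (Icc 0 c.dur) := by
        refine Filter.liminf_le_of_frequently_le' (Filter.Eventually.frequently ?_)
        filter_upwards [Filter.eventually_ne_atTop 0] with N hN using hbound N hN
    _ < ⊤ := ENNReal.mul_lt_top ENNReal.ofReal_lt_top c.variation_ne_top.lt_top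

theorem integrableOn_winding (g : PlanarPath) :
    IntegrableOn (fun z => (g.winding z : ℝ)) g.closing.imageᶜ :=
  ⟨g.continuousOn_winding.aestronglyMeasurable
    g.closing.isCompact_image.isClosed.isOpen_compl.measurableSet, g.lintegral_winding_lt_top⟩

theorem integrableOn_snd_mul_winding (g : PlanarPath) :
    IntegrableOn (fun z => z.2 * (g.winding z : ℝ)) g.closing.imageᶜ := by
  obtain ⟨R, hR⟩ := g.exists_winding_eq_zero
  have hm := g.closing.isCompact_image.isClosed.isOpen_compl.measurableSet
  refine Integrable.mono' (g.integrableOn_winding.norm.const_mul R)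
    ((continuousOn_snd.mul g.continuousOn_winding).aestronglyMeasurable hm) ?_
  filter_upwards [ae_restrict_mem hm] with z hz
  by_cases hzR : R < ‖planeToComplex z‖
  · simp [hR z hz hzR]
  · rw [norm_mul]
    gcongr
    exact (abs_im_le_norm z).trans (not_lt.1 hzR)

theorem restrict_compl_image (g : PlanarPath) :
    (volume : Measure (ℝ × ℝ)).restrict g.imageᶜ = volume :=
  Measure.restrict_eq_self_of_ae_mem g.ae_notMem_image

theorem integrable_winding (g : PlanarPath) : Integrable fun z => (g.winding z : ℝ) := by
  have := g.integrableOn_winding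
  rwa [IntegrableOn, restrict_compl_image] at this

theorem integrable_snd_mul_winding (g : PlanarPath) :
    Integrable fun z => z.2 * (g.winding z : ℝ) := by
  have := g.integrableOn_snd_mul_winding
  rwa [IntegrableOn, restrict_compl_image] at this

theorem area_eq (g : PlanarPath) : g.area = ∫ z, (g.winding z : ℝ) := by
  rw [area, restrict_compl_image]

theorem bary_eq (g : PlanarPath) : g.bary = ∫ z, z.2 * (g.winding z : ℝ) := by
  rw [bary, restrict_compl_image]

end PlanarPath

/-! ### Additivity of winding numbers up to a triangle -/

namespace PlanarPath

theorem segmentAngle_lt_pi {z v : ℝ × ℝ} (hz : z ∉ (segment v).image) :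
    segmentAngle z 0 v < Real.pi :=
  lt_of_le_of_ne (Complex.arg_le_pi _) (Complex.mem_slitPlane_iff_arg.1 (div_mem_slitPlane hz)).1

theorem segmentAngle_sub (z p q v : ℝ × ℝ) :
    segmentAngle (z - v) p q = segmentAngle z (p + v) (q + v) := by
  rw [segmentAngle, segmentAngle]
  congr 3 <;> abel

theorem segmentAngle_swap {z p q : ℝ × ℝ} (h : segmentAngle z p q ≠ Real.pi) :
    segmentAngle z q p = -segmentAngle z p q := by
  rw [segmentAngle, segmentAngle, ← inv_div, Complex.arg_inv]
  exact if_neg h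

/-- Inverting the quotient negates its argument unless that argument is π, which cannot happen off
the segment. -/
theorem segmentAngle_back {z v : ℝ × ℝ} (hz : z ∉ (segment v).image) :
    segmentAngle (z - v) 0 (-v) = -segmentAngle z 0 v := by
  rw [segmentAngle_sub, zero_add, neg_add_cancel]
  exact segmentAngle_swap (segmentAngle_lt_pi hz).ne

theorem notMem_of_notMem_closing {g : PlanarPath} {z : ℝ × ℝ} (hz : z ∉ g.closing.image) :
    z ∉ g.image ∧ z - g.endpoint ∉ (segment (-g.endpoint)).image := by
  rwa [closing, mem_image_concat, not_or] at hz

/-- The winding number in terms of the angle swept by the path and the angle of the closing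
segment. -/
theorem two_pi_mul_winding_eq {g : PlanarPath} {z : ℝ × ℝ} (hz : z ∉ g.closing.image) :
    2 * Real.pi * g.winding z =
      g.angle z + segmentAngle (z - g.endpoint) 0 (-g.endpoint) := by
  rw [two_pi_mul_winding hz, ← angle_segment (notMem_of_notMem_closing hz).2]
  exact angle_concat hz

/-- The first two sides of the triangle cancel the closing segments of g and h, and its third side
is the closing segment of gh. -/
theorem winding_concat {g h : PlanarPath} {z : ℝ × ℝ} (h1 : z ∉ g.closing.image)
    (h2 : z - g.endpoint ∉ h.closing.image) (h3 : z ∉ (g.concat h).closing.image)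
    (h4 : z ∉ ((segment g.endpoint).concat (segment h.endpoint)).closing.image) :
    (g.concat h).winding z = g.winding z + h.winding (z - g.endpoint) +
      ((segment g.endpoint).concat (segment h.endpoint)).winding z := by
  have e1 := two_pi_mul_winding_eq h1
  have e2 := two_pi_mul_winding_eq h2
  have e3 := two_pi_mul_winding_eq h3
  have e4 := two_pi_mul_winding_eq h4
  have h5 := (notMem_of_notMem_closing h4).1
  rw [angle_concat (notMem_of_notMem_closing h3).1] at e3
  rw [angle_concat h5] at e4
  rw [mem_image_concat, not_or] at h5
  simp only [endpoint_concat, endpoint_segment] at e3 e4 h5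
  rw [angle_segment h5.1, angle_segment h5.2] at e4
  rw [segmentAngle_back h5.1] at e1
  rw [segmentAngle_back h5.2] at e2
  have : 2 * Real.pi * ((g.concat h).winding z : ℝ) = 2 * Real.pi * (g.winding z +
      h.winding (z - g.endpoint) +
        ((segment g.endpoint).concat (segment h.endpoint)).winding z : ℤ) := by
    push_cast
    linarith
  exact_mod_cast mul_left_cancel₀ (by positivity) this

theorem ae_winding_concat (g h : PlanarPath) :
    ∀ᵐ z, ((g.concat h).winding z : ℝ) = g.winding z + h.winding (z - g.endpoint) +
      ((segment g.endpoint).concat (segment h.endpoint)).winding z := by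
  filter_upwards [g.closing.ae_notMem_image, h.closing.ae_sub_notMem_image g.endpoint,
    (g.concat h).closing.ae_notMem_image,
    ((segment g.endpoint).concat (segment h.endpoint)).closing.ae_notMem_image] with z h1 h2 h3 h4
  exact_mod_cast winding_concat h1 h2 h3 h4

theorem area_concat_eq (g h : PlanarPath) :
    (g.concat h).area = g.area + h.area +
      ((segment g.endpoint).concat (segment h.endpoint)).area := by
  simp only [area_eq]
  have hi := h.integrable_winding.comp_sub_right g.endpoint
  rw [integral_congr_ae (g.ae_winding_concat h),
    integral_add (g.integrable_winding.fun_add hi) (integrable_winding _),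
    integral_add g.integrable_winding hi,
    integral_sub_right_eq_self (fun z => (h.winding z : ℝ))]

theorem bary_concat_eq (g h : PlanarPath) :
    (g.concat h).bary = g.bary + h.bary + g.endpoint.2 * h.area +
      ((segment g.endpoint).concat (segment h.endpoint)).bary := by
  simp only [area_eq, bary_eq]
  have h1 := h.integrable_winding.comp_sub_right g.endpoint
  have h2 := h.integrable_snd_mul_winding.comp_sub_right g.endpoint
  -- Writing y = (y - y_g) + y_g on the translated term produces the summand y_g A(h).
  have e : (fun z : ℝ × ℝ => z.2 * ((g.concat h).winding z : ℝ)) =ᵐ[volume] fun z =>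
      z.2 * (g.winding z : ℝ) + (z - g.endpoint).2 * (h.winding (z - g.endpoint) : ℝ) +
        g.endpoint.2 * (h.winding (z - g.endpoint) : ℝ) +
        z.2 * (((segment g.endpoint).concat (segment h.endpoint)).winding z : ℝ) := by
    filter_upwards [g.ae_winding_concat h] with z hz
    rw [hz, Prod.snd_sub]
    ring
  rw [integral_congr_ae e,
    integral_add ((g.integrable_snd_mul_winding.fun_add h2).fun_add (h1.const_mul _))
      (integrable_snd_mul_winding _),
    integral_add (g.integrable_snd_mul_winding.fun_add h2) (h1.const_mul _),
    integral_add g.integrable_snd_mul_winding h2, integral_const_mul,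
    integral_sub_right_eq_self (fun z => (h.winding z : ℝ)),
    integral_sub_right_eq_self (fun z : ℝ × ℝ => z.2 * (h.winding z : ℝ))]

/-! ### Winding number, area and first moment of a triangle -/

theorem _root_.Complex.arg_pos_iff_of_mem_slitPlane {x : ℂ} (hx : x ∈ Complex.slitPlane) :
    0 < x.arg ↔ 0 < x.im := by
  constructor
  · intro h
    rw [← Complex.norm_mul_sin_arg]
    refine mul_pos (norm_pos_iff.2 (Complex.slitPlane_ne_zero hx))
      (Real.sin_pos_of_pos_of_lt_pi h ?_)
    exact lt_of_le_of_ne (Complex.arg_le_pi _) (Complex.mem_slitPlane_iff_arg.1 hx).1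
  · intro h
    refine lt_of_le_of_ne (Complex.arg_nonneg_iff.2 h.le) fun h0 => h.ne' ?_
    rw [← Complex.norm_mul_sin_arg, ← h0, Real.sin_zero, mul_zero]

/-- The sign of the angle under which a segment is seen is given by the orientation. -/
theorem segmentAngle_sign {z v : ℝ × ℝ} (hz : z ∉ (segment v).image) :
    (0 < segmentAngle z 0 v ↔ 0 < planarDet v z) ∧
      (segmentAngle z 0 v < 0 ↔ planarDet v z < 0) := by
  have hs := div_mem_slitPlane hz
  have h0 : planeToComplex (0 - z) ≠ 0 := fun h =>
    Complex.slitPlane_ne_zero hs (by rw [h, div_zero])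
  have him : (planeToComplex (v - z) / planeToComplex (0 - z)).im =
      planarDet v z / Complex.normSq (planeToComplex (0 - z)) := by
    rw [Complex.div_im, ← sub_div]
    congr 1
    simp [planarDet]
    ring
  have hn := Complex.normSq_pos.2 h0
  rw [segmentAngle, Complex.arg_pos_iff_of_mem_slitPlane hs, Complex.arg_neg_iff, him]
  exact ⟨div_pos_iff_of_pos_right hn, by rw [div_lt_iff₀ hn, zero_mul]⟩

/-- The winding number of the boundary of the triangle with vertices `0`, `u`, `u + v`, in terms of
the orientations of the triangles which a point forms with the three sides. -/
noncomputable def triangleIndex (u v z : ℝ × ℝ) : ℝ :=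
  if 0 < planarDet u z ∧ 0 < planarDet v (z - u) ∧ 0 < planarDet z (u + v) then 1 else
  if planarDet u z < 0 ∧ planarDet v (z - u) < 0 ∧ planarDet z (u + v) < 0 then -1 else 0

/-- The three side angles lie strictly between -π and π and sum to 2πn. So |n| ≤ 1, and n = ±1
requires all three to have the same sign. -/
theorem winding_triangle {u v z : ℝ × ℝ}
    (hz : z ∉ ((segment u).concat (segment v)).closing.image) :
    (((segment u).concat (segment v)).winding z : ℝ) = triangleIndex u v z := by
  have e := two_pi_mul_winding_eq hz
  obtain ⟨h12, h3⟩ := notMem_of_notMem_closing hz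
  rw [angle_concat h12] at e
  rw [mem_image_concat, not_or] at h12
  simp only [endpoint_concat, endpoint_segment] at e h12 h3
  rw [angle_segment h12.1, angle_segment h12.2] at e
  have s1 := segmentAngle_sign h12.1
  have s2 := segmentAngle_sign h12.2
  have s3 := segmentAngle_sign h3
  have hdet : planarDet (-(u + v)) (z - (u + v)) = planarDet z (u + v) := by
    simp [planarDet]
    ring
  rw [hdet] at s3
  have p1 := segmentAngle_lt_pi h12.1
  have p2 := segmentAngle_lt_pi h12.2
  have p3 := segmentAngle_lt_pi h3
  have n1 : -Real.pi < segmentAngle z 0 u := Complex.neg_pi_lt_arg _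
  have n2 : -Real.pi < segmentAngle (z - u) 0 v := Complex.neg_pi_lt_arg _
  have n3 : -Real.pi < segmentAngle (z - (u + v)) 0 (-(u + v)) := Complex.neg_pi_lt_arg _
  generalize segmentAngle z 0 u = a₁ at *
  generalize segmentAngle (z - u) 0 v = a₂ at *
  generalize segmentAngle (z - (u + v)) 0 (-(u + v)) = a₃ at *
  generalize ((segment u).concat (segment v)).winding z = n at *
  have hpi := Real.pi_pos
  have lower : ∀ m : ℤ, 2 * Real.pi * m < a₁ + a₂ + a₃ → m < n := fun m hm => by
    rw [← e] at hm
    exact_mod_cast lt_of_mul_lt_mul_left hm (by positivity)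
  have upper : ∀ m : ℤ, a₁ + a₂ + a₃ < 2 * Real.pi * m → n < m := fun m hm => by
    rw [← e] at hm
    exact_mod_cast lt_of_mul_lt_mul_left hm (by positivity)
  simp only [triangleIndex, ← s1.1, ← s2.1, ← s3.1, ← s1.2, ← s2.2, ← s3.2]
  split_ifs with hp hn
  · have h1 := lower 0 (by push_cast; linarith)
    have h2 := upper 2 (by push_cast; linarith)
    exact_mod_cast (by omega : n = 1)
  · have h1 := lower (-2) (by push_cast; linarith)
    have h2 := upper 0 (by push_cast; linarith)
    exact_mod_cast (by omega : n = -1)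
  · have hlo : -(2 * Real.pi) < a₁ + a₂ + a₃ := by
      by_contra hcon
      exact hn ⟨by linarith, by linarith, by linarith⟩
    have hup : a₁ + a₂ + a₃ < 2 * Real.pi := by
      by_contra hcon
      exact hp ⟨by linarith, by linarith, by linarith⟩
    have h1 := lower (-1) (by push_cast; linarith)
    have h2 := upper 1 (by push_cast; linarith)
    exact_mod_cast (by omega : n = 0)

/-- The linear map sending the standard triangle to the triangle with vertices `0`, `u`, `u + v`. -/
noncomputable def triangleMap (u v : ℝ × ℝ) : ℝ × ℝ →L[ℝ] ℝ × ℝ :=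
  LinearMap.toContinuousLinearMap (Matrix.toLin (Module.Basis.finTwoProd ℝ)
    (Module.Basis.finTwoProd ℝ) !![u.1, u.1 + v.1; u.2, u.2 + v.2])

theorem triangleMap_apply (u v p : ℝ × ℝ) :
    triangleMap u v p = (u.1 * p.1 + (u.1 + v.1) * p.2, u.2 * p.1 + (u.2 + v.2) * p.2) := by
  simp [triangleMap, Matrix.toLin_finTwoProd_apply]

theorem det_triangleMap (u v : ℝ × ℝ) : (triangleMap u v).det = planarDet u v := by
  rw [triangleMap, ContinuousLinearMap.det, LinearMap.coe_toContinuousLinearMap,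
    LinearMap.det_toLin, Matrix.det_fin_two_of, planarDet]
  ring

/-- The open standard triangle. -/
def standardTriangle : Set (ℝ × ℝ) := {p | 0 < p.1 ∧ 0 < p.2 ∧ p.1 + p.2 < 1}

/-- Pulled back, the three orientations are det(u, v) times the barycentric coordinates of p. The
index is therefore the sign of det(u, v) on the standard triangle, and the Jacobian factor turns it
into det(u, v) itself. -/
theorem triangleIndex_triangleMap {u v : ℝ × ℝ} (h : planarDet u v ≠ 0) (p : ℝ × ℝ) :
    |planarDet u v| * triangleIndex u v (triangleMap u v p) =
      standardTriangle.indicator (fun _ => planarDet u v) p := by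
  have e1 : planarDet u (triangleMap u v p) = planarDet u v * p.2 := by
    simp [triangleMap_apply, planarDet]
    ring
  have e2 : planarDet v (triangleMap u v p - u) = planarDet u v * (1 - (p.1 + p.2)) := by
    simp [triangleMap_apply, planarDet]
    ring
  have e3 : planarDet (triangleMap u v p) (u + v) = planarDet u v * p.1 := by
    simp [triangleMap_apply, planarDet]
    ring
  rw [triangleIndex, e1, e2, e3]
  generalize planarDet u v = D at *
  rcases h.lt_or_gt with hD | hD
  · have hm : ∀ x, D * x < 0 ↔ 0 < x := fun x => by
      rw [mul_neg_iff]; constructor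
      · rintro (h | h) <;> linarith [h.1, h.2]
      · exact fun h => Or.inr ⟨hD, h⟩
    have hm' : ∀ x, 0 < D * x ↔ x < 0 := fun x => by
      rw [mul_pos_iff]; constructor
      · rintro (h | h) <;> linarith [h.1, h.2]
      · exact fun h => Or.inr ⟨hD, h⟩
    simp only [hm, hm', indicator_apply, standardTriangle, mem_ofPred_eq, abs_of_neg hD]
    rw [if_neg (by rintro ⟨h1, h2, h3⟩; linarith)]
    split_ifs with h1 h2 h2
    · ring
    · exact absurd ⟨h1.2.2, h1.1, by linarith [h1.2.1]⟩ h2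
    · exact absurd ⟨h2.2.1, by linarith [h2.2.2], h2.1⟩ h1
    · ring
  · have hm : ∀ x, 0 < D * x ↔ 0 < x := fun x => mul_pos_iff_of_pos_left hD
    have hm' : ∀ x, D * x < 0 ↔ x < 0 := fun x => by
      rw [mul_neg_iff]; constructor
      · rintro (h | h) <;> linarith [h.1, h.2]
      · exact fun h => Or.inl ⟨hD, h⟩
    simp only [hm, hm', indicator_apply, standardTriangle, mem_ofPred_eq, abs_of_pos hD]
    by_cases hc : 0 < p.1 ∧ 0 < p.2 ∧ p.1 + p.2 < 1
    · rw [if_pos ⟨hc.2.1, by linarith [hc.2.2], hc.1⟩, if_pos hc, mul_one]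
    · rw [if_neg fun h => hc ⟨h.2.2, h.1, by linarith [h.2.1]⟩,
        if_neg (by rintro ⟨h1, h2, h3⟩; linarith), if_neg hc, mul_zero]

theorem measurableSet_standardTriangle : MeasurableSet standardTriangle := by
  refine (IsOpen.and ?_ (IsOpen.and ?_ ?_)).measurableSet
  · exact isOpen_lt continuous_const continuous_fst
  · exact isOpen_lt continuous_const continuous_snd
  · exact isOpen_lt (continuous_fst.add continuous_snd) continuous_const

theorem integral_standardTriangle (α β γ : ℝ) :
    ∫ p in standardTriangle, (α + β * p.1 + γ * p.2) = α / 2 + β / 6 + γ / 6 := by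
  have hint : IntegrableOn (fun p : ℝ × ℝ => α + β * p.1 + γ * p.2) standardTriangle := by
    have hK : IsCompact (Icc (0 : ℝ) 1 ×ˢ Icc (0 : ℝ) 1) := isCompact_Icc.prod isCompact_Icc
    refine IntegrableOn.mono_set (ContinuousOn.integrableOn_compact hK (by fun_prop)) ?_
    rintro p ⟨h1, h2, h3⟩
    exact ⟨⟨h1.le, by linarith⟩, ⟨h2.le, by linarith⟩⟩
  rw [← integral_indicator measurableSet_standardTriangle, Measure.volume_eq_prod, integral_prod _
    ((integrable_indicator_iff measurableSet_standardTriangle).2 hint)]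
  have hinner : ∀ s : ℝ, ∫ t : ℝ, standardTriangle.indicator
      (fun p : ℝ × ℝ => α + β * p.1 + γ * p.2) (s, t) =
        (Ioc (0 : ℝ) 1).indicator (fun s => (α + β * s) * (1 - s) + γ * (1 - s) ^ 2 / 2) s := by
    intro s
    by_cases hs : s ∈ Ioc (0 : ℝ) 1
    · rw [indicator_of_mem hs]
      have : (fun t : ℝ => standardTriangle.indicator
          (fun p : ℝ × ℝ => α + β * p.1 + γ * p.2) (s, t)) =
          (Ioo 0 (1 - s)).indicator (fun t => (α + β * s) + γ * t) := by
        funext t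
        simp only [indicator_apply, standardTriangle, mem_ofPred_eq, mem_Ioo, hs.1, true_and,
          lt_sub_iff_add_lt']
      rw [this, integral_indicator measurableSet_Ioo, ← integral_Ioc_eq_integral_Ioo,
        ← intervalIntegral.integral_of_le (by linarith [hs.2]),
        intervalIntegral.integral_add (by simp)
          (Continuous.intervalIntegrable (by fun_prop) _ _),
        intervalIntegral.integral_const_mul, integral_id, intervalIntegral.integral_const,
        smul_eq_mul]
      ring
    · rw [indicator_of_notMem hs, ← integral_zero ℝ ℝ]
      congr 1
      funext t
      refine indicator_of_notMem ?_ _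
      rintro ⟨h1, h2, h3⟩
      exact hs ⟨h1, by dsimp only at h1 h2 h3; linarith⟩
  simp_rw [hinner]
  rw [integral_indicator measurableSet_Ioc, ← intervalIntegral.integral_of_le zero_le_one]
  have hF : ∀ s ∈ uIcc (0 : ℝ) 1, HasDerivAt
      (fun s : ℝ => α * s + (β - α) * s ^ 2 / 2 - β * s ^ 3 / 3 - γ * (1 - s) ^ 3 / 6)
      ((α + β * s) * (1 - s) + γ * (1 - s) ^ 2 / 2) s := by
    intro s _
    have h1 := (hasDerivAt_id s).const_mul α
    have h2 := (((hasDerivAt_id s).pow 2).const_mul (β - α)).div_const 2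
    have h3 := (((hasDerivAt_id s).pow 3).const_mul β).div_const 3
    have h4 := ((((hasDerivAt_id s).const_sub 1).pow 3).const_mul γ).div_const 6
    refine (((h1.add h2).sub h3).sub h4).congr_deriv ?_
    simp
    ring
  rw [intervalIntegral.integral_eq_sub_of_hasDerivAt hF
    (Continuous.intervalIntegrable (by fun_prop) _ _)]
  ring

theorem integral_mul_triangleIndex (u v : ℝ × ℝ) (f : ℝ × ℝ → ℝ) :
    ∫ z, f z * triangleIndex u v z =
      planarDet u v * ∫ p in standardTriangle, f (triangleMap u v p) := by
  by_cases h : planarDet u v = 0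
  · rw [h, zero_mul, ← integral_zero (ℝ × ℝ) ℝ]
    congr 1
    funext z
    -- In the degenerate case the three orientations sum to 0, so they never share a strict sign.
    have hsum : planarDet u z + planarDet v (z - u) + planarDet z (u + v) = 0 := by
      rw [← h]
      simp [planarDet]
      ring
    rw [triangleIndex, if_neg (by rintro ⟨h1, h2, h3⟩; linarith),
      if_neg (by rintro ⟨h1, h2, h3⟩; linarith), mul_zero]
  · have hdet : (triangleMap u v).det ≠ 0 := by rwa [det_triangleMap]
    have hbij : Function.Bijective (triangleMap u v) :=
      (LinearMap.equivOfDetNeZero (triangleMap u v : ℝ × ℝ →ₗ[ℝ] ℝ × ℝ) hdet).bijective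
    have := integral_image_eq_integral_abs_det_fderiv_smul volume MeasurableSet.univ
      (fun x _ => (triangleMap u v).hasFDerivAt.hasFDerivWithinAt) hbij.injective.injOn
      (fun z => f z * triangleIndex u v z)
    rw [image_univ, hbij.surjective.range_eq, setIntegral_univ, setIntegral_univ] at this
    rw [this, ← integral_const_mul, ← integral_indicator measurableSet_standardTriangle]
    classical
    congr 1
    funext p
    rw [det_triangleMap, smul_eq_mul, mul_left_comm, triangleIndex_triangleMap h,
      indicator_apply, indicator_apply]
    split_ifs <;> ring

theorem ae_winding_triangle (u v : ℝ × ℝ) :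
    (fun z => (((segment u).concat (segment v)).winding z : ℝ)) =ᵐ[volume] triangleIndex u v := by
  filter_upwards [((segment u).concat (segment v)).closing.ae_notMem_image] with z hz
    using winding_triangle hz

theorem area_triangle (u v : ℝ × ℝ) :
    ((segment u).concat (segment v)).area = 1 / 2 * planarDet u v := by
  have h1 := integral_mul_triangleIndex u v fun _ => 1
  have h2 := integral_standardTriangle 1 0 0
  simp only [one_mul] at h1
  simp only [zero_mul, add_zero] at h2
  rw [area_eq, integral_congr_ae (ae_winding_triangle u v), h1, h2]
  ring

theorem bary_triangle (u v : ℝ × ℝ) :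
    ((segment u).concat (segment v)).bary =
      1 / 3 * (2 * u.2 + v.2) * (1 / 2 * planarDet u v) := by
  have h1 := integral_mul_triangleIndex u v fun z => z.2
  have h2 := integral_standardTriangle 0 u.2 (u.2 + v.2)
  simp only [zero_add] at h2
  simp only [triangleMap_apply] at h1
  rw [bary_eq, integral_congr_ae ((ae_winding_triangle u v).mono fun z hz =>
    congrArg (z.2 * ·) hz), h1, h2]
  ring

theorem area_concat (g h : PlanarPath) :
    (g.concat h).area = g.area + h.area + 1 / 2 * planarDet g.endpoint h.endpoint := by
  rw [area_concat_eq, area_triangle]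

theorem bary_concat (g h : PlanarPath) :
    (g.concat h).bary = g.bary + h.bary + g.endpoint.2 * h.area +
      1 / 3 * (2 * g.endpoint.2 + h.endpoint.2) *
        (1 / 2 * planarDet g.endpoint h.endpoint) := by
  rw [bary_concat_eq, bary_triangle]

/-! ### Reverse paths, segments and the empty path -/

@[simp] theorem endpoint_reverse (g : PlanarPath) : g.reverse.endpoint = -g.endpoint := by
  simp [endpoint, reverse, g.start]

theorem mem_image_reverse {g : PlanarPath} {z : ℝ × ℝ} :
    z ∈ g.reverse.image ↔ z + g.endpoint ∈ g.image := by
  constructor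
  · rintro ⟨t, ht, rfl⟩
    exact ⟨g.dur - t, ⟨by linarith [show t ≤ g.dur from ht.2], by linarith [ht.1]⟩,
      (sub_add_cancel _ _).symm⟩
  · rintro ⟨t, ht, he⟩
    refine ⟨g.dur - t, ⟨by linarith [ht.2], show g.dur - t ≤ g.dur by linarith [ht.1]⟩, ?_⟩
    change g.toFun (g.dur - (g.dur - t)) - g.endpoint = z
    rw [sub_sub_cancel, he, add_sub_cancel_right]

theorem angle_reverse {g : PlanarPath} {z : ℝ × ℝ} (hz : z + g.endpoint ∉ g.image) :
    g.reverse.angle z = -g.angle (z + g.endpoint) := by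
  refine angle_eq (mem_image_reverse.not.2 hz) ?_
  have := (hasAngle hz).comp_sub_left g.dur
  rw [sub_self, sub_zero] at this
  refine this.congr fun t _ => ?_
  change planeToComplex _ = planeToComplex (g.toFun (g.dur - t) - g.endpoint - z)
  congr 1
  abel

theorem winding_reverse {g : PlanarPath} {z : ℝ × ℝ} (h1 : z + g.endpoint ∉ g.closing.image)
    (h2 : z ∉ g.reverse.closing.image) :
    g.reverse.winding z = -g.winding (z + g.endpoint) := by
  have e1 := two_pi_mul_winding_eq h1
  have e2 := two_pi_mul_winding_eq h2
  have h3 := (notMem_of_notMem_closing h2).2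
  rw [angle_reverse (notMem_of_notMem_closing h1).1] at e2
  simp only [endpoint_reverse, neg_neg, sub_neg_eq_add] at e2 h3
  rw [segmentAngle_back h3] at e1
  have : 2 * Real.pi * (g.reverse.winding z : ℝ) =
      2 * Real.pi * (-g.winding (z + g.endpoint) : ℤ) := by
    push_cast
    linarith
  exact_mod_cast mul_left_cancel₀ (by positivity) this

theorem ae_winding_reverse (g : PlanarPath) :
    ∀ᵐ z, (g.reverse.winding z : ℝ) = -(g.winding (z + g.endpoint) : ℝ) := by
  filter_upwards [g.closing.ae_sub_notMem_image (-g.endpoint),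
    g.reverse.closing.ae_notMem_image] with z h1 h2
  rw [sub_neg_eq_add] at h1
  exact_mod_cast winding_reverse h1 h2

theorem area_reverse (g : PlanarPath) : g.reverse.area = -g.area := by
  rw [area_eq, area_eq, integral_congr_ae g.ae_winding_reverse, integral_neg,
    integral_add_right_eq_self (fun z => (g.winding z : ℝ))]

theorem bary_reverse (g : PlanarPath) :
    g.reverse.bary = -g.bary + g.endpoint.2 * g.area := by
  have e : (fun z : ℝ × ℝ => z.2 * (g.reverse.winding z : ℝ)) =ᵐ[volume] fun z =>
      -((z + g.endpoint).2 * (g.winding (z + g.endpoint) : ℝ)) +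
        g.endpoint.2 * (g.winding (z + g.endpoint) : ℝ) := by
    filter_upwards [g.ae_winding_reverse] with z hz
    rw [hz, Prod.snd_add]
    ring
  rw [bary_eq, bary_eq, area_eq, integral_congr_ae e,
    integral_add (g.integrable_snd_mul_winding.comp_add_right g.endpoint).fun_neg
      ((g.integrable_winding.comp_add_right g.endpoint).const_mul _),
    integral_neg, integral_const_mul,
    integral_add_right_eq_self (fun z => (g.winding z : ℝ)),
    integral_add_right_eq_self (fun z : ℝ × ℝ => z.2 * (g.winding z : ℝ))]

theorem winding_segment {v z : ℝ × ℝ} (hz : z ∉ (segment v).closing.image) :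
    (segment v).winding z = 0 := by
  have e := two_pi_mul_winding_eq hz
  have h := (notMem_of_notMem_closing hz).1
  rw [angle_segment h, endpoint_segment, segmentAngle_back h, add_neg_cancel] at e
  exact_mod_cast (mul_eq_zero.1 e).resolve_left (by positivity)

theorem area_segment (v : ℝ × ℝ) : (segment v).area = 0 := by
  rw [area, setIntegral_eq_zero_of_forall_eq_zero fun z hz => by rw [winding_segment hz]; simp]

theorem bary_segment (v : ℝ × ℝ) : (segment v).bary = 0 := by
  rw [bary, setIntegral_eq_zero_of_forall_eq_zero fun z hz => by rw [winding_segment hz]; simp]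

@[simp] theorem endpoint_empty : empty.endpoint = 0 := rfl

/-- The empty path is its own reverse, and reversal negates the area. -/
theorem area_empty : empty.area = 0 := by
  have h1 := area_reverse empty
  have : empty.reverse = empty := by
    simp [empty, reverse, endpoint]
  rw [this] at h1
  linarith

theorem bary_empty : empty.bary = 0 := by
  have h1 := bary_reverse empty
  have : empty.reverse = empty := by
    simp [empty, reverse, endpoint]
  rw [this, endpoint_empty, Prod.snd_zero, zero_mul] at h1
  linarith

end PlanarPath

/-! ### Compatibility with the equivalence and realisation of all parameters -/

namespace PlanarPath

theorem equiv_iff {g h : PlanarPath} :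
    g ≈ h ↔ g.endpoint = h.endpoint ∧ g.area = h.area ∧ g.bary = h.bary := Iff.rfl

theorem concat_equiv {g g' h h' : PlanarPath} (hg : g ≈ g') (hh : h ≈ h') :
    g.concat h ≈ g'.concat h' := by
  rw [equiv_iff] at *
  obtain ⟨h1, h2, h3⟩ := hg
  obtain ⟨k1, k2, k3⟩ := hh
  simp only [endpoint_concat, area_concat, bary_concat, h1, h2, h3, k1, k2, k3, and_self]

/-- The boundary of a rectangle of width `a` and height `b`. -/
noncomputable def rectangle (a b : ℝ) : PlanarPath :=
  ((segment (a, 0)).concat (segment (0, b))).concat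
    ((segment (-a, 0)).concat (segment (0, -b)))

theorem endpoint_rectangle (a b : ℝ) : (rectangle a b).endpoint = 0 := by
  simp [rectangle]

theorem area_rectangle (a b : ℝ) : (rectangle a b).area = a * b := by
  simp [rectangle, area_concat, area_segment, planarDet]
  ring

theorem bary_rectangle (a b : ℝ) : (rectangle a b).bary = a * b ^ 2 / 2 := by
  simp [rectangle, area_concat, bary_concat, area_segment, bary_segment, planarDet]
  ring

theorem exists_coords (x y A B : ℝ) :
    ∃ g : PlanarPath, g.endpoint = (x, y) ∧ g.area = A ∧ g.bary = B := by
  -- Rectangles of heights 1 and 2 have independent pairs (A, B_y); the widths solve a₁ + 2a₂ = A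
  -- and a₁/2 + 2a₂ = B. Being closed and placed before the segment, they create no cross terms.
  refine ⟨((rectangle (2 * (A - B)) 1).concat (rectangle ((2 * B - A) / 2) 2)).concat
    (segment (x, y)), ?_, ?_, ?_⟩
  · simp [endpoint_rectangle]
  · simp [area_concat, endpoint_rectangle, area_rectangle, area_segment, planarDet]
    ring
  · simp [bary_concat, endpoint_rectangle, bary_rectangle, area_segment,
      bary_segment, planarDet]
    ring

end PlanarPath

/-! ### Group law, Lie group structure and matrix model -/

namespace EngelBar

open PlanarPath

theorem coords_toEngel (g : PlanarPath) :
    coords g.toEngel = (g.endpoint.1, g.endpoint.2, g.area, g.bary) := rfl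

theorem exists_toEngel (p : EngelBar) : ∃ g : PlanarPath, g.toEngel = p := Quotient.exists_rep p

theorem coords_injective : Function.Injective coords := by
  intro p q h
  obtain ⟨g, rfl⟩ := exists_toEngel p
  obtain ⟨k, rfl⟩ := exists_toEngel q
  simp only [coords_toEngel, Prod.mk.injEq] at h
  exact Quotient.sound ⟨Prod.ext h.1 h.2.1, h.2.2.1, h.2.2.2⟩

theorem coords_surjective : Function.Surjective coords := by
  rintro ⟨x, y, A, B⟩
  obtain ⟨g, h1, h2, h3⟩ := exists_coords x y A B
  exact ⟨g.toEngel, by rw [coords_toEngel, h1, h2, h3]⟩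

theorem isOpenEmbedding_coords : Topology.IsOpenEmbedding coords where
  eq_induced := rfl
  injective := coords_injective
  isOpen_range := by rw [coords_surjective.range_eq]; exact isOpen_univ

/-- The group law in the coordinates `(x, y, A, B_y)`. -/
noncomputable def coordMul (p q : ℝ × ℝ × ℝ × ℝ) : ℝ × ℝ × ℝ × ℝ :=
  (p.1 + q.1, p.2.1 + q.2.1, p.2.2.1 + q.2.2.1 + 1 / 2 * (p.1 * q.2.1 - p.2.1 * q.1),
    p.2.2.2 + q.2.2.2 + p.2.1 * q.2.2.1 +
      1 / 3 * (2 * p.2.1 + q.2.1) * (1 / 2 * (p.1 * q.2.1 - p.2.1 * q.1)))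

/-- The inverse in the coordinates `(x, y, A, B_y)`. -/
noncomputable def coordInv (p : ℝ × ℝ × ℝ × ℝ) : ℝ × ℝ × ℝ × ℝ :=
  (-p.1, -p.2.1, -p.2.2.1, -p.2.2.2 + p.2.1 * p.2.2.1)

theorem coords_concat (g h : PlanarPath) :
    coords (g.concat h).toEngel = coordMul (coords g.toEngel) (coords h.toEngel) := by
  simp only [coords_toEngel, coordMul, endpoint_concat, area_concat, bary_concat, planarDet,
    Prod.fst_add, Prod.snd_add]

theorem coords_reverse (g : PlanarPath) :
    coords g.reverse.toEngel = coordInv (coords g.toEngel) := by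
  simp only [coords_toEngel, coordInv, endpoint_reverse, area_reverse, bary_reverse,
    Prod.fst_neg, Prod.snd_neg]

theorem coords_empty : coords PlanarPath.empty.toEngel = 0 := by
  simp only [coords_toEngel, endpoint_empty, area_empty, bary_empty]
  rfl

/-- Concatenation of classes of paths. -/
noncomputable abbrev engelMul : Mul EngelBar :=
  ⟨Quotient.map₂ PlanarPath.concat fun _ _ hg _ _ hh => concat_equiv hg hh⟩

attribute [local instance] engelMul

/-- The class of the empty path. -/
noncomputable abbrev engelOne : One EngelBar := ⟨PlanarPath.empty.toEngel⟩

attribute [local instance] engelOne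

/-- The class of the reverse path. -/
noncomputable abbrev engelInv : Inv EngelBar :=
  ⟨Quotient.map PlanarPath.reverse fun g h hgh => by
    rw [equiv_iff] at *
    obtain ⟨h1, h2, h3⟩ := hgh
    simp only [endpoint_reverse, area_reverse, bary_reverse, h1, h2, h3, and_self]⟩

attribute [local instance] engelInv

theorem toEngel_mul (g h : PlanarPath) : g.toEngel * h.toEngel = (g.concat h).toEngel := rfl

theorem toEngel_inv (g : PlanarPath) : g.toEngel⁻¹ = g.reverse.toEngel := rfl

theorem coords_mul (p q : EngelBar) : coords (p * q) = coordMul (coords p) (coords q) := by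
  obtain ⟨g, rfl⟩ := exists_toEngel p
  obtain ⟨h, rfl⟩ := exists_toEngel q
  exact coords_concat g h

theorem coords_inv (p : EngelBar) : coords p⁻¹ = coordInv (coords p) := by
  obtain ⟨g, rfl⟩ := exists_toEngel p
  exact coords_reverse g

theorem coords_one : coords 1 = 0 := coords_empty

/-- The group structure of `Ē`. -/
noncomputable abbrev engelGroup : Group EngelBar :=
  -- The operations are the ones already defined by paths; injectivity of `coords` turns each axiom
  -- into polynomial identities.
  Group.ofLeftAxioms
    (fun p q r => coords_injective <| by
      simp only [coords_mul, coordMul, Prod.mk.injEq]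
      refine ⟨?_, ?_, ?_, ?_⟩ <;> ring)
    (fun p => coords_injective <| by
      simp [coords_mul, coordMul, coords_one])
    (fun p => coords_injective <| by
      simp only [coords_mul, coords_inv, coordMul, coordInv, coords_one, Prod.ext_iff,
        Prod.fst_zero, Prod.snd_zero]
      refine ⟨?_, ?_, ?_, ?_⟩ <;> ring)

attribute [local instance] engelGroup

theorem contDiff_coordMul :
    ContDiff ℝ ∞ fun p : (ℝ × ℝ × ℝ × ℝ) × (ℝ × ℝ × ℝ × ℝ) => coordMul p.1 p.2 := by
  unfold coordMul
  fun_prop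

theorem contDiff_coordInv : ContDiff ℝ ∞ coordInv := by
  unfold coordInv
  fun_prop

/-- Smoothness may be tested after composing with the global chart, where product and inverse are
polynomial. -/
theorem lieGroup (hc : Topology.IsOpenEmbedding coords) :
    haveI : Nonempty EngelBar := ⟨1⟩
    letI : ChartedSpace (ℝ × ℝ × ℝ × ℝ) EngelBar := hc.singletonChartedSpace
    LieGroup 𝓘(ℝ, ℝ × ℝ × ℝ × ℝ) ∞ EngelBar := by
  have : Nonempty EngelBar := ⟨1⟩
  let _ : ChartedSpace (ℝ × ℝ × ℝ × ℝ) EngelBar := hc.singletonChartedSpace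
  have hcoords : ContMDiff 𝓘(ℝ, ℝ × ℝ × ℝ × ℝ) 𝓘(ℝ, ℝ × ℝ × ℝ × ℝ) ∞ coords :=
    contMDiff_isOpenEmbedding hc
  have hM : IsManifold 𝓘(ℝ, ℝ × ℝ × ℝ × ℝ) ∞ EngelBar := hc.isManifold_singleton
  have hmul : ContMDiff ((𝓘(ℝ, ℝ × ℝ × ℝ × ℝ)).prod 𝓘(ℝ, ℝ × ℝ × ℝ × ℝ))
      𝓘(ℝ, ℝ × ℝ × ℝ × ℝ) ∞ fun p : EngelBar × EngelBar => p.1 * p.2 := by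
    refine ContMDiff.of_comp_isOpenEmbedding hc ?_
    have e : (coords ∘ fun p : EngelBar × EngelBar => p.1 * p.2) =
        (fun p : (ℝ × ℝ × ℝ × ℝ) × (ℝ × ℝ × ℝ × ℝ) => coordMul p.1 p.2) ∘
          fun p : EngelBar × EngelBar => (coords p.1, coords p.2) :=
      funext fun p => coords_mul p.1 p.2
    rw [e]
    exact contDiff_coordMul.contMDiff.comp
      ((hcoords.comp contMDiff_fst).prodMk_space (hcoords.comp contMDiff_snd))
  have hinv : ContMDiff 𝓘(ℝ, ℝ × ℝ × ℝ × ℝ) 𝓘(ℝ, ℝ × ℝ × ℝ × ℝ) ∞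
      fun p : EngelBar => p⁻¹ := by
    refine ContMDiff.of_comp_isOpenEmbedding hc ?_
    have e : (coords ∘ fun p : EngelBar => p⁻¹) = coordInv ∘ coords := funext coords_inv
    rw [e]
    exact contDiff_coordInv.contMDiff.comp hcoords
  exact { hM with
    contMDiff_mul := hmul
    contMDiff_inv := hinv }

/-- The matrix of the element with given coordinates `(x, y, A, B_y)`. -/
noncomputable def coordMatrix (p : ℝ × ℝ × ℝ × ℝ) : Matrix (Fin 4) (Fin 4) ℝ :=
  engelMatrix p.2.1 p.1 (p.1 * p.2.1 / 2 - p.2.2.1) (p.1 * p.2.1 ^ 2 / 6 - p.2.2.2)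

/-- Replacing A by xy/2 - A turns the antisymmetric term (xy' - yx')/2 of the group law into the
matrix term yx'; the correction xy²/6 plays the same role for B_y. -/
theorem coordMatrix_mul (p q : ℝ × ℝ × ℝ × ℝ) :
    coordMatrix p * coordMatrix q = coordMatrix (coordMul p q) := by
  rw [coordMatrix, coordMatrix, coordMatrix, engelMatrix_mul]
  simp only [coordMul]
  congr 1 <;> ring

theorem coordMatrix_zero : coordMatrix 0 = 1 := by
  rw [← engelMatrix_zero]
  simp [coordMatrix]

theorem coordMatrix_mul_coords_inv (p : EngelBar) :
    coordMatrix (coords p) * coordMatrix (coords p⁻¹) = 1 := by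
  rw [coordMatrix_mul, ← coords_mul, mul_inv_cancel, coords_one, coordMatrix_zero]

theorem engelMatrix_injective {a b c d a' b' c' d' : ℝ}
    (h : engelMatrix a b c d = engelMatrix a' b' c' d') :
    a = a' ∧ b = b' ∧ c = c' ∧ d = d' := by
  refine ⟨?_, ?_, ?_, ?_⟩
  · simpa [engelMatrix] using congrFun (congrFun h 0) 1
  · simpa [engelMatrix] using congrFun (congrFun h 2) 3
  · simpa [engelMatrix] using congrFun (congrFun h 1) 3
  · simpa [engelMatrix] using congrFun (congrFun h 0) 3

/-- The matrix representation of `Ē`. -/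
noncomputable def toMatrixHom : EngelBar →* engelMatrixGroup where
  -- The inverse matrix is supplied as the matrix of the inverse class.
  toFun p := ⟨⟨coordMatrix (coords p), coordMatrix (coords p⁻¹), coordMatrix_mul_coords_inv p, by
    simpa using coordMatrix_mul_coords_inv p⁻¹⟩, _, _, _, _, rfl⟩
  map_one' := by
    ext1
    ext1
    change coordMatrix (coords 1) = 1
    rw [coords_one, coordMatrix_zero]
  map_mul' p q := by
    ext1
    ext1
    change coordMatrix (coords (p * q)) = coordMatrix (coords p) * coordMatrix (coords q)
    rw [coords_mul, coordMatrix_mul]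

theorem coe_toMatrixHom (p : EngelBar) :
    ((toMatrixHom p : GL (Fin 4) ℝ) : Matrix (Fin 4) (Fin 4) ℝ) = coordMatrix (coords p) := rfl

theorem toMatrixHom_bijective : Function.Bijective toMatrixHom := by
  constructor
  · intro p q h
    have hm : coordMatrix (coords p) = coordMatrix (coords q) := by
      rw [← coe_toMatrixHom, ← coe_toMatrixHom, h]
    obtain ⟨h1, h2, h3, h4⟩ := engelMatrix_injective hm
    rw [h1, h2] at h3 h4
    exact coords_injective (Prod.ext h2 (Prod.ext h1 (Prod.ext (by simpa using h3)
      (by simpa using h4))))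
  · rintro ⟨M, a, b, c, d, hM⟩
    -- The entries c = xy/2 - A and d = xy²/6 - B_y are solved for A and B_y, with x = b and y = a.
    obtain ⟨p, hp⟩ := coords_surjective (b, a, b * a / 2 - c, b * a ^ 2 / 6 - d)
    refine ⟨p, ?_⟩
    ext1
    ext1
    rw [coe_toMatrixHom, hp, hM]
    simp [coordMatrix]

/-- The isomorphism of `Ē` with the Engel group. -/
noncomputable def matrixEquiv : EngelBar ≃* engelMatrixGroup :=
  MulEquiv.ofBijective toMatrixHom toMatrixHom_bijective

end EngelBar

theorem mainTheorem1 :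
    -- the winding numbers are well defined, and the integrals defining `A` and `B_y` converge
    (∀ g : PlanarPath,
      (∀ z ∈ g.closing.imageᶜ, ∃! n : ℤ, g.closing.IsWindingNumber z n) ∧
      IntegrableOn (fun z : ℝ × ℝ => (g.winding z : ℝ)) g.closing.imageᶜ ∧
      IntegrableOn (fun z : ℝ × ℝ => z.2 * (g.winding z : ℝ)) g.closing.imageᶜ) ∧
    -- the parameters of a concatenation
    (∀ g h : PlanarPath,
      (g.concat h).endpoint = g.endpoint + h.endpoint ∧
      (g.concat h).area = g.area + h.area + 1 / 2 * planarDet g.endpoint h.endpoint ∧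
      (g.concat h).bary = g.bary + h.bary + g.endpoint.2 * h.area +
        1 / 3 * (2 * g.endpoint.2 + h.endpoint.2) *
          (1 / 2 * planarDet g.endpoint h.endpoint)) ∧
    -- concatenation passes to the quotient
    (∀ g g' h h' : PlanarPath, g ≈ g' → h ≈ h' → g.concat h ≈ g'.concat h') ∧
    -- the quotient is a group, with the empty path as neutral element and reverse paths as
    -- inverses
    ∃ G : Group EngelBar,
      (∀ g h : PlanarPath, g.toEngel * h.toEngel = (g.concat h).toEngel) ∧
      PlanarPath.empty.toEngel = 1 ∧
      (∀ g : PlanarPath, g.toEngel⁻¹ = g.reverse.toEngel) ∧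
      -- it is a Lie group, with `(x, y, A, B_y)` as a global chart onto `ℝ⁴`
      Function.Surjective EngelBar.coords ∧
      (∃ hc : Topology.IsOpenEmbedding EngelBar.coords,
        haveI : Nonempty EngelBar := ⟨1⟩
        letI : ChartedSpace (ℝ × ℝ × ℝ × ℝ) EngelBar := hc.singletonChartedSpace
        LieGroup 𝓘(ℝ, ℝ × ℝ × ℝ × ℝ) ∞ EngelBar) ∧
      -- it is the Engel group
      (∃ Φ : EngelBar ≃* engelMatrixGroup, ∀ g : PlanarPath,
        ((Φ g.toEngel : GL (Fin 4) ℝ) : Matrix (Fin 4) (Fin 4) ℝ) =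
          engelMatrix g.endpoint.2 g.endpoint.1
            (g.endpoint.1 * g.endpoint.2 / 2 - g.area)
            (g.endpoint.1 * g.endpoint.2 ^ 2 / 6 - g.bary)) := by
  refine ⟨fun g => ⟨fun z hz =>
      PlanarPath.existsUnique_isWindingNumber g.endpoint_closing hz,
      g.integrableOn_winding, g.integrableOn_snd_mul_winding⟩,
    fun g h => ⟨PlanarPath.endpoint_concat g h, PlanarPath.area_concat g h,
      PlanarPath.bary_concat g h⟩,
    fun _ _ _ _ => PlanarPath.concat_equiv, EngelBar.engelGroup, EngelBar.toEngel_mul, rfl,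
    EngelBar.toEngel_inv, EngelBar.coords_surjective,
    ⟨EngelBar.isOpenEmbedding_coords, EngelBar.lieGroup _⟩,
    EngelBar.matrixEquiv, fun g => rfl⟩
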